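/- Let $\Omega=(-1,1)^2$, with closed sides $\Gamma_1=\{1\}\times[-1,1]$ (right), $\Gamma_2=[-1,1]\times\{1\}$ (top), $\Gamma_3=\{-1\}\times[-1,1]$ (left), $\Gamma_4=[-1,1]\times\{-1\}$ (bottom), and $\Gamma=\Gamma_1\cup\Gamma_2$. Let $\mathbf N=(N_1,N_2)$ with integers $N_1,N_2\ge 1$. For $n\ge1$ let $L_n$ be the Legendre polynomial of degree $n$, let $-1=x_0<\dots<x_n=1$ be the Legendre–Gauss–Lobatto (LGL) nodes, i.e. the roots of $(1-x^2)L_n'(x)$, let $\Psi_i$ be the polynomial of degree $n$ with $\Psi_i(x_j)=\delta_{ij}$, and let $\omega_i=\int_{-1}^1\Psi_i\,dx$ be the LGL quadrature weights. Let $h^{L},h^{R}$ be the polynomials of degree at most $n$ that vanish at $\pm1$ and satisfy $h^{L}(x_i)=\frac{1-x_i}2$, $h^{R}(x_i)=\frac{1+x_i}2$ for $0<i<n$, and put $$G^{L}_n=\frac{(h^{L})''}{\sqrt{\omega_0}}-\frac{\Psi_0'}{\omega_0\sqrt{\omega_0}},\qquad G^{R}_n=\frac{(h^{R})''}{\sqrt{\omega_n}}+\frac{\Psi_n'}{\omega_n\sqrt{\omega_n}}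 .$$ Put $G_1(\mathbf x)=G^R_{N_1}(x_1)$, $G_2(\mathbf x)=G^R_{N_2}(x_2)$, $G_3(\mathbf x)=G^L_{N_1}(x_1)$, $G_4(\mathbf x)=G^L_{N_2}(x_2)$. Let $C$ be the tensor grid of LGL nodes of degrees $N_1$ in $x_1$ and $N_2$ in $x_2$, and $C^\Omega=C\cap\Omega$. Let $\mathbb P_{\mathbf N}$ be the space of real polynomials in $(x_1,x_2)$ of degree at most $N_i$ in $x_i$ ($i=1,2$), and $\mathbb P_{\mathbf N}^{Di}$ the subspace of those vanishing on $\partial\Omega$. A discrete control on a side $\Gamma_k$ is a function in $L^2((0,T)\times\Gamma_k)$ that for every $t\in(0,T)$ is, along $\Gamma_k$, a polynomial in the tangential variable of degree at most the corresponding $N_i$; $\pi_k$ denotes the orthogonal projection onto $\Gamma_k$. **Theorem.** Let $T>4\sqrt2\,(2+N_1^{-1})(2+N_2^{-1})$ and $u^{0,\mathbf N},u^{1,\mathbf N}\in\mathbb P^{Di}_{\mathbf N}$. Then there exist a function $f^{\mathbf N}$ on $(0,T)\times\Gamma$ whose restrictions to $\Gamma_1$ and $\Gamma_2$ are discrete controls,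 and discrete controls $g_k^{\mathbf N}$ on $\Gamma_k$, $k=1,\dots,4$, such that the system $$\begin{cases}(u_{tt}-\Delta u)(t,\mathbf x)=\sum_{k=1}^4 g_k^{\mathbf N}(t,\pi_k\mathbf x)\,G_k(\mathbf x), & t\in(0,T),\ \mathbf x\in C^\Omega,\\ u(t,\mathbf x)=f^{\mathbf N}(t,\mathbf x), & t\in(0,T),\ \mathbf x\in C\cap\Gamma,\\ u(t,\mathbf x)=0, & t\in(0,T),\ \mathbf x\in C\cap(\Gamma_3\cup\Gamma_4),\\ u(0,\mathbf x)=u^{0,\mathbf N}(\mathbf x),\quad u_t(0,\mathbf x)=u^{1,\mathbf N}(\mathbf x), & \mathbf x\in C^\Omega,\end{cases}$$ has a $\mathbb P_{\mathbf N}$-valued solution that is $C^\infty$ in time on $(0,T)$, and every $\mathbb P_{\mathbf N}$-valued solution $u$ on $[0,T]$ satisfies $$u(T,\mathbf x)=u_t(T,\mathbf x)=0\qquad\text{for all }\mathbf x\in C^\Omega .$$ Here, the controls being only $L^2$ in time, a solution is understood in the sense of Carathéodory: at each $\mathbf x\in C^\Omega$, $u(\cdot,\mathbf x)$ is differentiable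 on $[0,T]$ with an absolutely continuous derivative, and the first three lines of the system hold for almost every $t\in(0,T)$. -/

import Mathlib

open scoped ContDiff Nat

noncomputable section

namespace Collocation

/-! ### One-dimensional Legendre-Gauss-Lobatto collocation -/

/-- The Legendre polynomial of degree `n` on `(-1, 1)` (Rodrigues' formula). -/
def legendre (n : ℕ) : Polynomial ℝ :=
  Polynomial.C (1 / ((2 : ℝ) ^ n * (n ! : ℝ))) *
    Polynomial.derivative^[n] ((Polynomial.X ^ 2 - 1) ^ n)

/-- The Legendre-Gauss-Lobatto nodes: the roots of `(1 - x ^ 2) * Lₙ'(x)`. -/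
def lglNodes (n : ℕ) : Finset ℝ :=
  ((1 - Polynomial.X ^ 2) * Polynomial.derivative (legendre n)).roots.toFinset

/-- The Lagrange polynomial that is `1` at the node `y` and `0` at all the other nodes. -/
def cardinal (n : ℕ) (y : ℝ) : Polynomial ℝ :=
  Lagrange.basis (lglNodes n) id y

/-- The weight of the node `y` in the (interpolatory) LGL quadrature formula. -/
def lglWeight (n : ℕ) (y : ℝ) : ℝ :=
  ∫ x in (-1 : ℝ)..1, (cardinal n y).eval x

/-- For `e = 1` (resp. `e = -1`), the polynomial `h ^ R` (resp. `h ^ L`) of degree at most `n` that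
vanishes at `-1` and `1` and takes the value `(1 + e * x) / 2` at every interior node `x`. -/
def lift (n : ℕ) (e : ℝ) : Polynomial ℝ :=
  Lagrange.interpolate (lglNodes n) id
    (fun x => if x = -1 ∨ x = 1 then 0 else (1 + e * x) / 2)

/-- The profile of the artificial control attached to the endpoint `e ∈ {-1, 1}`, that is
`G ^ R = h ^ R'' / √ω + Ψ' / (√ω * ω)` for `e = 1` and
`G ^ L = h ^ L'' / √ω - Ψ' / (√ω * ω)` for `e = -1`, where `Ψ` and `ω` are the Lagrange polynomial
and the weight of the node `e`. -/
def profile (n : ℕ) (e : ℝ) : Polynomial ℝ :=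
  Polynomial.C (1 / √(lglWeight n e)) * Polynomial.derivative^[2] (lift n e) +
    Polynomial.C (e / (√(lglWeight n e) * lglWeight n e)) *
      Polynomial.derivative (cardinal n e)

/-! ### The square `(-1, 1) ^ 2`, its sides and its grid

The degrees are `N = (N 0, N 1)`.  The sides are numbered `0` (right, `x 0 = 1`), `1` (top,
`x 1 = 1`), `2` (left, `x 0 = -1`), `3` (bottom, `x 1 = -1`). -/

/-- The coordinate that is constant on the side `k`. -/
def axis : Fin 4 → Fin 2 := ![0, 1, 0, 1]

/-- The value of that coordinate on the side `k`. -/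
def endpoint : Fin 4 → ℝ := ![1, 1, -1, -1]

/-- The coordinate that varies along the side `k`. -/
def tangent : Fin 4 → Fin 2 := ![1, 0, 1, 0]

/-- The (closed) side `k` of the square. -/
def side (k : Fin 4) : Set (Fin 2 → ℝ) :=
  {x | x (axis k) = endpoint k ∧ x (tangent k) ∈ Set.Icc (-1 : ℝ) 1}

/-- The orthogonal projection of the square onto the side `k`. -/
def sideProj (k : Fin 4) (x : Fin 2 → ℝ) : Fin 2 → ℝ :=
  Function.update x (axis k) (endpoint k)

/-- The point of the side `k` with tangential coordinate `s` (arc length parametrization). -/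
def sidePoint (k : Fin 4) (s : ℝ) : Fin 2 → ℝ :=
  sideProj k (fun _ => s)

/-- All the collocation nodes: the tensor grid of LGL nodes. -/
def grid (N : Fin 2 → ℕ) : Set (Fin 2 → ℝ) :=
  {x | ∀ i, x i ∈ lglNodes (N i)}

/-- The collocation nodes that lie in the open square. -/
def interiorGrid (N : Fin 2 → ℕ) : Set (Fin 2 → ℝ) :=
  {x | x ∈ grid N ∧ ∀ i, x i ∈ Set.Ioo (-1 : ℝ) 1}

/-! ### Polynomial spaces -/

/-- Polynomials of degree at most `N i` in the variable `x i`. -/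
def polySpace (N : Fin 2 → ℕ) : Set (MvPolynomial (Fin 2) ℝ) :=
  {p | ∀ i, p.degreeOf i ≤ N i}

/-- The elements of `polySpace N` that vanish on the boundary of the square. -/
def polySpaceDi (N : Fin 2 → ℕ) : Set (MvPolynomial (Fin 2) ℝ) :=
  {p | p ∈ polySpace N ∧ ∀ k, ∀ x ∈ side k, MvPolynomial.eval x p = 0}

/-- The Laplacian of a polynomial in two variables. -/
def laplacian (p : MvPolynomial (Fin 2) ℝ) : MvPolynomial (Fin 2) ℝ :=
  ∑ i, MvPolynomial.pderiv i (MvPolynomial.pderiv i p)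

/-! ### The discrete control problem -/

/-- `g` is a discrete control on the side `k`: it is square integrable on `(0, T) × side k`, and at
each time it is, along the side, a polynomial of degree at most `N` in the tangential variable, so
that its values at the nodes of the side are meaningful. -/
structure IsDiscreteControl (N : Fin 2 → ℕ) (T : ℝ) (k : Fin 4)
    (g : ℝ → (Fin 2 → ℝ) → ℝ) : Prop where
  polynomial : ∀ t ∈ Set.Ioo 0 T, ∃ p : Polynomial ℝ, p.natDegree ≤ N (tangent k) ∧
    ∀ x ∈ side k, g t x = p.eval (x (tangent k))
  memLp : MeasureTheory.MemLp (fun q : ℝ × ℝ => g q.1 (sidePoint k q.2)) 2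
    ((MeasureTheory.volume.restrict (Set.Ioo 0 T)).prod
      (MeasureTheory.volume.restrict (Set.Icc (-1 : ℝ) 1)))

/-- The source term `∑ₖ gₖ(t, x) Gₖ(x)` at an interior point `x`.  As `gₖ` lives on the side `k`, it
is evaluated at the projection of `x` onto that side; `Gₖ` depends only on the coordinate normal to
the side. -/
def source (N : Fin 2 → ℕ) (g : Fin 4 → ℝ → (Fin 2 → ℝ) → ℝ) (t : ℝ) (x : Fin 2 → ℝ) : ℝ :=
  ∑ k, g k t (sideProj k x) * (profile (N (axis k)) (endpoint k)).eval (x (axis k))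

/-- `u` is a solution on `[0, T]` of the collocation system with boundary control `f` on the right
and top sides, artificial controls `g` and initial data `u0`, `u1`.  Since the controls are only
square integrable in time, the equation is understood in the sense of Carathéodory: at an interior
node `u` is continuously differentiable in time, its time derivative `v` is absolutely continuous,
and the equation holds for almost every time; the boundary conditions hold for almost every time. -/
structure IsSolution (N : Fin 2 → ℕ) (T : ℝ) (f : ℝ → (Fin 2 → ℝ) → ℝ)
    (g : Fin 4 → ℝ → (Fin 2 → ℝ) → ℝ) (u0 u1 : MvPolynomial (Fin 2) ℝ)
    (u : ℝ → MvPolynomial (Fin 2) ℝ) : Prop where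
  mem_polySpace : ∀ t ∈ Set.Icc 0 T, u t ∈ polySpace N
  equation : ∀ x ∈ interiorGrid N, ∃ v : ℝ → ℝ,
    AbsolutelyContinuousOnInterval v 0 T ∧
    (∀ t ∈ Set.Icc 0 T,
      HasDerivWithinAt (fun s => MvPolynomial.eval x (u s)) (v t) (Set.Icc 0 T) t) ∧
    (∀ᵐ t ∂(MeasureTheory.volume.restrict (Set.Ioo 0 T)),
      HasDerivAt v (MvPolynomial.eval x (laplacian (u t)) + source N g t x) t) ∧
    MvPolynomial.eval x (u 0) = MvPolynomial.eval x u0 ∧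
    v 0 = MvPolynomial.eval x u1
  controlled : ∀ x ∈ grid N, x ∈ side 0 ∪ side 1 →
    ∀ᵐ t ∂(MeasureTheory.volume.restrict (Set.Ioo 0 T)), MvPolynomial.eval x (u t) = f t x
  uncontrolled : ∀ x ∈ grid N, x ∈ side 2 ∪ side 3 →
    ∀ᵐ t ∂(MeasureTheory.volume.restrict (Set.Ioo 0 T)), MvPolynomial.eval x (u t) = 0

/-- `u` is infinitely differentiable in time on `(0, T)`. -/
def IsSmoothInTime (T : ℝ) (u : ℝ → MvPolynomial (Fin 2) ℝ) : Prop :=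
  ∀ x : Fin 2 → ℝ, ContDiffOn ℝ ∞ (fun t => MvPolynomial.eval x (u t)) (Set.Ioo 0 T)

/-- At time `T`, `u` and its time derivative vanish at all the interior nodes. -/
def IsAtRest (N : Fin 2 → ℕ) (T : ℝ) (u : ℝ → MvPolynomial (Fin 2) ℝ) : Prop :=
  ∀ x ∈ interiorGrid N, MvPolynomial.eval x (u T) = 0 ∧
    HasDerivWithinAt (fun t => MvPolynomial.eval x (u t)) 0 (Set.Icc 0 T) T

end Collocation

end

/-! # Exact controllability of the collocated wave equation on a square

At the interior nodes the system is a linear system `U'' = A U + B c` with smooth controls `c`, where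
`A` is the collocated Laplacian with homogeneous Dirichlet conditions (`dirichletLaplacian`) and `B`
collects the effect of the boundary control and of the artificial controls (`controlOperator`).  Such
a system can be steered to rest as soon as no proper subspace is invariant under `A` and contains the
range of `B` (`exists_null_control`): the free evolution is cut off by a smooth function of time, and
the right-hand side left by the cut-off is compensated by controls and trajectories supported in the
middle of the time interval, which exist for right-hand sides along every direction of the smallest
invariant subspace containing the range of `B`.

The condition on subspaces is a unique continuation property of the adjoint system
(`eq_top_of_artificialColumn_mem`).  The quadrature formula with `n + 1` nodes is exact up to degree
`2 n - 1` (`sum_lglWeight_mul_eval`), so that discrete integration by parts holds: `A` is symmetric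
and negative definite for the inner product given by the weights.  The profiles of the artificial
controls are designed so that the adjoint observation is, up to a nonzero factor, the second normal
derivative at the nodes of the sides (`sum_lglWeight_profile_mul`).  Consider a polynomial `p`,
vanishing on the boundary of the square, that annihilates an invariant subspace containing the range
of `B`.  Its second normal derivatives vanish at the nodes of the boundary, hence so does its whole
Laplacian, and `Δ p` is again such a polynomial.  Thus the true Laplacian maps the space of these
polynomials to itself.  There it is injective by negative definiteness, and nilpotent because it
lowers the degree; so the space is zero.

The controls are finally read off from their nodal values by Lagrange interpolation, and solutions in
the sense of Carathéodory are unique at the interior nodes since the controls are smooth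
(`eq_zero_of_caratheodory`).
-/

namespace Collocation

open Polynomial

/-! ### Integrals of polynomials over `[-1, 1]` -/

theorem intervalIntegrable_eval (p : ℝ[X]) (a b : ℝ) :
    IntervalIntegrable (fun x => p.eval x) MeasureTheory.volume a b :=
  p.continuous.intervalIntegrable a b

theorem integral_eval_derivative (p : ℝ[X]) :
    ∫ x in (-1 : ℝ)..1, (derivative p).eval x = p.eval 1 - p.eval (-1) :=
  intervalIntegral.integral_eq_sub_of_hasDerivAt (fun x _ => p.hasDerivAt x)
    (intervalIntegrable_eval _ _ _)

theorem integral_eval_add (p q : ℝ[X]) :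
    ∫ x in (-1 : ℝ)..1, (p + q).eval x =
      (∫ x in (-1 : ℝ)..1, p.eval x) + ∫ x in (-1 : ℝ)..1, q.eval x := by
  simp only [eval_add]
  exact intervalIntegral.integral_add (intervalIntegrable_eval _ _ _)
    (intervalIntegrable_eval _ _ _)

theorem integral_eval_C_mul (c : ℝ) (p : ℝ[X]) :
    ∫ x in (-1 : ℝ)..1, (C c * p).eval x = c * ∫ x in (-1 : ℝ)..1, p.eval x := by
  simp only [eval_mul, eval_C]
  exact intervalIntegral.integral_const_mul _ _

/-- Integration by parts for polynomials. -/
theorem integral_eval_derivative_mul (p q : ℝ[X]) :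
    ∫ x in (-1 : ℝ)..1, (derivative p * q).eval x =
      (p * q).eval 1 - (p * q).eval (-1) - ∫ x in (-1 : ℝ)..1, (p * derivative q).eval x := by
  rw [← integral_eval_derivative, derivative_mul, integral_eval_add]
  ring

theorem integral_eval_pos {p : ℝ[X]} (hp : p ≠ 0)
    (hnn : ∀ x ∈ Set.Icc (-1 : ℝ) 1, 0 ≤ p.eval x) :
    0 < ∫ x in (-1 : ℝ)..1, p.eval x := by
  obtain ⟨c, hc, hpc⟩ : ∃ c ∈ Set.Icc (-1 : ℝ) 1, p.eval c ≠ 0 := by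
    by_contra! h
    refine hp (p.eq_zero_of_infinite_isRoot ((Set.Icc_infinite (by norm_num :
      (-1 : ℝ) < 1)).mono fun x hx => h x hx))
  refine intervalIntegral.integral_pos (by norm_num) p.continuous.continuousOn
    (fun x hx => hnn x ⟨hx.1.le, hx.2⟩) ⟨c, hc, lt_of_le_of_ne (hnn c hc) hpc.symm⟩

/-! ### Legendre-Gauss-Lobatto nodes -/

/-- The derivatives of `(X ^ 2 - 1) ^ n` of order less than `n` vanish at `1` and `-1`. -/
theorem eval_iterate_derivative_rodrigues {n k : ℕ} (hk : k < n) {e : ℝ} (he : e ^ 2 = 1) :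
    (derivative^[k] ((X ^ 2 - 1 : ℝ[X]) ^ n)).eval e = 0 := by
  have h1 : (X - C e) ^ n ∣ (X ^ 2 - 1 : ℝ[X]) ^ n :=
    pow_dvd_pow_of_dvd (dvd_iff_isRoot.2 (by simp [IsRoot, he])) n
  have h2 := pow_sub_dvd_iterate_derivative_of_pow_dvd k h1
  have h3 : (X - C e) ∣ (X - C e) ^ (n - k) := dvd_pow_self _ (by omega)
  exact dvd_iff_isRoot.1 (h3.trans h2)

/-- By Rolle's theorem, each derivative of `(X ^ 2 - 1) ^ n` of order less than `n` gains a root,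
as those at `1` and `-1` persist. -/
theorem card_roots_iterate_derivative_rodrigues {n k : ℕ} (hk : k < n) :
    k + 2 ≤ (derivative^[k] ((X ^ 2 - 1 : ℝ[X]) ^ n)).roots.toFinset.card := by
  induction k with
  | zero =>
    have h0 : ((X ^ 2 - 1 : ℝ[X]) ^ n) ≠ 0 := by
      refine pow_ne_zero _ (X_pow_sub_C_ne_zero (by norm_num) (1 : ℝ))
    have : ({1, -1} : Finset ℝ) ⊆ ((X ^ 2 - 1 : ℝ[X]) ^ n).roots.toFinset := by
      intro x hx
      simp only [Finset.mem_insert, Finset.mem_singleton] at hx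
      rw [Multiset.mem_toFinset, mem_roots h0]
      have := eval_iterate_derivative_rodrigues (k := 0) hk (e := x)
        (by rcases hx with rfl | rfl <;> norm_num)
      simpa using this
    have h2 : ({1, -1} : Finset ℝ).card = 2 := by
      rw [Finset.card_pair (by norm_num)]
    simpa [h2] using Finset.card_le_card this
  | succ k ih =>
    have ih := ih (by omega)
    set p := derivative^[k] ((X ^ 2 - 1 : ℝ[X]) ^ n) with hp
    have hp' : derivative^[k + 1] ((X ^ 2 - 1 : ℝ[X]) ^ n) = derivative p := by
      rw [Function.iterate_succ_apply']
    rw [hp']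
    have h1 := card_roots_toFinset_le_card_roots_derivative_sdiff_roots_succ p
    have hp0 : p ≠ 0 := by rintro h; simp [h] at ih
    have hd0 : derivative p ≠ 0 := by rintro h; simp [h] at h1; omega
    have hsub : ((derivative p).roots.toFinset \ p.roots.toFinset) ∪ {1, -1} ⊆
        (derivative p).roots.toFinset := by
      refine Finset.union_subset Finset.sdiff_subset fun x hx => ?_
      simp only [Finset.mem_insert, Finset.mem_singleton] at hx
      rw [Multiset.mem_toFinset, mem_roots hd0, ← hp']
      exact eval_iterate_derivative_rodrigues hk
        (by rcases hx with rfl | rfl <;> norm_num)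
    have hdis : Disjoint ((derivative p).roots.toFinset \ p.roots.toFinset) {1, -1} := by
      rw [Finset.disjoint_right]
      intro x hx hx'
      simp only [Finset.mem_insert, Finset.mem_singleton] at hx
      refine (Finset.mem_sdiff.1 hx').2 ?_
      rw [Multiset.mem_toFinset, mem_roots hp0]
      exact eval_iterate_derivative_rodrigues (by omega)
        (by rcases hx with rfl | rfl <;> norm_num)
    have h2 : ({1, -1} : Finset ℝ).card = 2 := Finset.card_pair (by norm_num)
    have := Finset.card_le_card hsub
    rw [Finset.card_union_of_disjoint hdis, h2] at this
    omega

theorem integral_iterate_derivative_rodrigues_mul {n k : ℕ} (hk : k ≤ n) (q : ℝ[X]) :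
    ∫ x in (-1 : ℝ)..1, (derivative^[k] ((X ^ 2 - 1 : ℝ[X]) ^ n) * q).eval x =
      (-1) ^ k * ∫ x in (-1 : ℝ)..1, ((X ^ 2 - 1 : ℝ[X]) ^ n * derivative^[k] q).eval x := by
  induction k generalizing q with
  | zero => simp
  | succ k ih =>
    rw [Function.iterate_succ_apply', integral_eval_derivative_mul, ih (by omega),
      eval_mul, eval_mul, eval_iterate_derivative_rodrigues hk (by norm_num),
      eval_iterate_derivative_rodrigues hk (by norm_num), Function.iterate_succ_apply]
    ring

/-- Legendre's differential equation, integrated once: the polynomial `(1 - x ^ 2) Lₙ'` whose roots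
are the nodes is a multiple of the derivative of order `n - 1` of `(x ^ 2 - 1) ^ n`. -/
theorem one_sub_sq_mul_derivative_legendre (m : ℕ) :
    ∃ c : ℝ, c ≠ 0 ∧ (1 - X ^ 2) * derivative (legendre (m + 1)) =
      C c * derivative^[m] ((X ^ 2 - 1 : ℝ[X]) ^ (m + 1)) := by
  set W : ℝ[X] := (X ^ 2 - 1) ^ (m + 1) with hW
  have hC2 : (C (2 : ℝ)) = (2 : ℝ[X]) := rfl
  -- the equation `(X² - 1) W' = 2 n X W`, differentiated `k` times
  have key : ∀ k : ℕ, (X ^ 2 - 1) * derivative^[k + 2] W + C (2 * (k + 1 : ℝ)) * X *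
      derivative^[k + 1] W + C ((k : ℝ) * (k + 1)) * derivative^[k] W =
      C (2 * (m + 1 : ℝ)) * (X * derivative^[k + 1] W + C (k + 1 : ℝ) * derivative^[k] W) := by
    have h0 : (X ^ 2 - 1) * derivative W = C (2 * (m + 1 : ℝ)) * (X * W) := by
      rw [hW, derivative_pow]
      simp only [derivative_sub, derivative_X_pow, derivative_one, map_mul, map_add, map_one,
        map_ofNat, map_natCast, Nat.cast_add, Nat.cast_one, Nat.add_sub_cancel]
      ring
    intro k
    induction k with
    | zero =>
      have := congrArg derivative h0
      simp only [derivative_mul, derivative_sub, derivative_X_pow, derivative_one, derivative_C,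
        derivative_X] at this
      simp only [Function.iterate_succ_apply', Function.iterate_zero_apply]
      simp [hC2] at this ⊢
      linear_combination this
    | succ k ih =>
      have := congrArg derivative ih
      simp only [derivative_mul, derivative_sub, derivative_X_pow, derivative_one, derivative_C,
        derivative_X, derivative_add, ← Function.iterate_succ_apply' derivative] at this
      simp [hC2] at this ⊢
      linear_combination this
  have h := key m
  refine ⟨-(1 / (2 ^ (m + 1) * ((m + 1) ! : ℝ))) * ((m + 1) * (m + 2)), ?_, ?_⟩
  · have : ((m + 1) ! : ℝ) ≠ 0 := by positivity
    refine mul_ne_zero (neg_ne_zero.2 (by positivity)) (by positivity)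
  · rw [legendre, derivative_C_mul, ← Function.iterate_succ_apply' derivative]
    simp only [map_mul, map_neg, map_add, map_one, map_ofNat, map_natCast] at h ⊢
    linear_combination (-C (1 / (2 ^ (m + 1) * ((m + 1) ! : ℝ)))) * h

theorem lglNodes_eq (m : ℕ) :
    lglNodes (m + 1) = (derivative^[m] ((X ^ 2 - 1 : ℝ[X]) ^ (m + 1))).roots.toFinset := by
  obtain ⟨c, hc, h⟩ := one_sub_sq_mul_derivative_legendre m
  rw [lglNodes, h, roots_C_mul _ hc]

theorem natDegree_iterate_derivative_rodrigues_le (m : ℕ) :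
    (derivative^[m] ((X ^ 2 - 1 : ℝ[X]) ^ (m + 1))).natDegree ≤ m + 2 := by
  have h1 := natDegree_iterate_derivative ((X ^ 2 - 1 : ℝ[X]) ^ (m + 1)) m
  have h2 : ((X ^ 2 - 1 : ℝ[X]) ^ (m + 1)).natDegree ≤ (m + 1) * 2 := by
    refine natDegree_pow_le_of_le _ ?_
    compute_degree
  omega

theorem iterate_derivative_rodrigues_ne_zero (m : ℕ) :
    derivative^[m] ((X ^ 2 - 1 : ℝ[X]) ^ (m + 1)) ≠ 0 := by
  intro h
  have := card_roots_iterate_derivative_rodrigues (Nat.lt_succ_self m)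
  simp [h] at this

theorem card_lglNodes {n : ℕ} (hn : 1 ≤ n) : (lglNodes n).card = n + 1 := by
  obtain ⟨m, rfl⟩ := Nat.exists_eq_add_of_le' hn
  rw [lglNodes_eq]
  refine le_antisymm ?_ (card_roots_iterate_derivative_rodrigues (Nat.lt_succ_self m))
  refine (Multiset.toFinset_card_le _).trans ((card_roots' _).trans ?_)
  exact natDegree_iterate_derivative_rodrigues_le m

theorem endpoint_mem_lglNodes {n : ℕ} (hn : 1 ≤ n) {e : ℝ} (he : e ^ 2 = 1) :
    e ∈ lglNodes n := by
  obtain ⟨m, rfl⟩ := Nat.exists_eq_add_of_le' hn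
  rw [lglNodes_eq, Multiset.mem_toFinset, mem_roots (iterate_derivative_rodrigues_ne_zero m)]
  exact eval_iterate_derivative_rodrigues (Nat.lt_succ_self m) he

theorem injOn_id_lglNodes (n : ℕ) : Set.InjOn (id : ℝ → ℝ) (lglNodes n) :=
  Function.injective_id.injOn

/-- The node polynomial of degree `n + 1` is orthogonal to the polynomials of degree less than
`n - 1`, by repeated integration by parts. -/
theorem integral_nodal_mul_eq_zero {m : ℕ} {q : ℝ[X]} (hq : derivative^[m] q = 0) :
    ∫ x in (-1 : ℝ)..1,
      (derivative^[m] ((X ^ 2 - 1 : ℝ[X]) ^ (m + 1)) * q).eval x = 0 := by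
  rw [integral_iterate_derivative_rodrigues_mul (Nat.le_succ m), hq]
  simp

/-- The nodes lie in `[-1, 1]`: if `r` were a node outside, the node polynomial would be
`(X ^ 2 - 1) (X - r) s`, and its orthogonality to `s` would contradict the constant sign of
`(X ^ 2 - 1) (X - r) s ^ 2` on `[-1, 1]`. -/
theorem mem_Icc_of_mem_lglNodes {n : ℕ} (hn : 1 ≤ n) {r : ℝ} (hr : r ∈ lglNodes n) :
    r ∈ Set.Icc (-1 : ℝ) 1 := by
  obtain ⟨m, rfl⟩ := Nat.exists_eq_add_of_le' hn
  rw [lglNodes_eq, Multiset.mem_toFinset, mem_roots (iterate_derivative_rodrigues_ne_zero m)] at hr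
  set w := derivative^[m] ((X ^ 2 - 1 : ℝ[X]) ^ (m + 1)) with hw
  have hw0 : w ≠ 0 := iterate_derivative_rodrigues_ne_zero m
  by_contra hout
  have hr1 : r - 1 ≠ 0 := by
    intro h
    exact hout ⟨by linarith, by linarith⟩
  have hr2 : r + 1 ≠ 0 := by
    intro h
    exact hout ⟨by linarith, by linarith⟩
  have hw1 : w.IsRoot 1 := eval_iterate_derivative_rodrigues (Nat.lt_succ_self m) (one_pow 2)
  obtain ⟨a, ha⟩ := dvd_iff_isRoot.2 hw1
  have ha1 : a.IsRoot (-1) := by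
    have h : w.eval (-1) = 0 :=
      eval_iterate_derivative_rodrigues (Nat.lt_succ_self m) (by norm_num)
    rw [ha, eval_mul] at h
    exact (mul_eq_zero.1 h).resolve_left (by norm_num)
  obtain ⟨b, hb⟩ := dvd_iff_isRoot.2 ha1
  have hb1 : b.IsRoot r := by
    have h : w.eval r = 0 := hr
    rw [ha, hb, eval_mul, eval_mul] at h
    refine ((mul_eq_zero.1 h).resolve_left (by simpa using hr1) |> mul_eq_zero.1).resolve_left ?_
    simpa using hr2
  obtain ⟨s, hs⟩ := dvd_iff_isRoot.2 hb1
  have hws : w = (X - C 1) * ((X - C (-1)) * ((X - C r) * s)) := by rw [← hs, ← hb, ← ha]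
  have hs0 : s ≠ 0 := by
    rintro rfl
    exact hw0 (by simp [hws])
  have hdeg : s.natDegree < m := by
    have h1 := natDegree_iterate_derivative_rodrigues_le m
    rw [← hw, hws, natDegree_mul (X_sub_C_ne_zero _) (mul_ne_zero (X_sub_C_ne_zero _)
      (mul_ne_zero (X_sub_C_ne_zero _) hs0)), natDegree_mul (X_sub_C_ne_zero _)
      (mul_ne_zero (X_sub_C_ne_zero _) hs0), natDegree_mul (X_sub_C_ne_zero _) hs0] at h1
    simp only [natDegree_X_sub_C] at h1
    omega
  have h0 := integral_nodal_mul_eq_zero (iterate_derivative_eq_zero hdeg)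
  rw [← hw] at h0
  have hprod : w * s ≠ 0 := mul_ne_zero hw0 hs0
  have hev : ∀ x, (w * s).eval x = (1 - x ^ 2) * (r - x) * (s.eval x) ^ 2 := by
    intro x
    simp only [hws, eval_mul, eval_sub, eval_X, eval_C]
    ring
  rcases le_or_gt r 1 with h | h
  · have hr' : r < -1 := by
      by_contra h'
      exact hout ⟨by linarith, h⟩
    have := integral_eval_pos (p := C (-1) * (w * s)) (mul_ne_zero (by simp) hprod) (by
      intro x hx
      rw [eval_mul, eval_C, hev]
      have h1 : 0 ≤ 1 - x ^ 2 := by nlinarith [hx.1, hx.2]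
      have h2 : 0 ≤ x - r := by linarith [hx.1]
      have := mul_nonneg (mul_nonneg h1 h2) (sq_nonneg (s.eval x))
      linarith)
    rw [integral_eval_C_mul, h0] at this
    simp at this
  · have := integral_eval_pos hprod (by
      intro x hx
      rw [hev]
      have h1 : 0 ≤ 1 - x ^ 2 := by nlinarith [hx.1, hx.2]
      have h2 : 0 ≤ r - x := by linarith [hx.2]
      positivity)
    rw [h0] at this
    exact lt_irrefl _ this

/-! ### Lagrange interpolation and quadrature at the nodes -/

theorem eval_cardinal_self {n : ℕ} {y : ℝ} (hy : y ∈ lglNodes n) : (cardinal n y).eval y = 1 :=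
  Lagrange.eval_basis_self (injOn_id_lglNodes n) hy

theorem eval_cardinal_of_ne {n : ℕ} {y z : ℝ} (hyz : y ≠ z) (hz : z ∈ lglNodes n) :
    (cardinal n y).eval z = 0 :=
  Lagrange.eval_basis_of_ne (v := id) hyz hz

theorem natDegree_cardinal {n : ℕ} (hn : 1 ≤ n) {y : ℝ} (hy : y ∈ lglNodes n) :
    (cardinal n y).natDegree = n := by
  rw [cardinal, Lagrange.natDegree_basis (injOn_id_lglNodes n) hy, card_lglNodes hn]
  rfl

/-- A polynomial of degree at most `n` is the interpolant of its values at the nodes. -/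
theorem eq_sum_cardinal {n : ℕ} (hn : 1 ≤ n) {p : ℝ[X]} (hp : p.natDegree ≤ n) :
    p = ∑ y ∈ lglNodes n, C (p.eval y) * cardinal n y := by
  have := Lagrange.eq_interpolate (f := p) (injOn_id_lglNodes n) (by
    rw [card_lglNodes hn]
    refine degree_le_natDegree.trans_lt ?_
    exact_mod_cast Nat.lt_succ_of_le hp)
  rw [Lagrange.interpolate_apply] at this
  exact this

theorem integral_eval_sum {ι : Type*} (s : Finset ι) (f : ι → ℝ[X]) :
    ∫ x in (-1 : ℝ)..1, (∑ i ∈ s, f i).eval x = ∑ i ∈ s, ∫ x in (-1 : ℝ)..1, (f i).eval x := by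
  simp only [eval_finsetSum]
  exact intervalIntegral.integral_finsetSum fun i _ => intervalIntegrable_eval _ _ _

/-- The LGL quadrature formula is exact up to degree `2 n - 1`: divide by the node polynomial, which
is orthogonal to the quotient, and interpolate the remainder. -/
theorem sum_lglWeight_mul_eval {n : ℕ} (hn : 1 ≤ n) {p : ℝ[X]} (hp : p.natDegree ≤ 2 * n - 1) :
    ∑ y ∈ lglNodes n, lglWeight n y * p.eval y = ∫ x in (-1 : ℝ)..1, p.eval x := by
  obtain ⟨m, rfl⟩ := Nat.exists_eq_add_of_le' hn
  set w := derivative^[m] ((X ^ 2 - 1 : ℝ[X]) ^ (m + 1)) with hw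
  have hw0 : w ≠ 0 := iterate_derivative_rodrigues_ne_zero m
  have hwdeg : w.natDegree = m + 2 := by
    refine le_antisymm (natDegree_iterate_derivative_rodrigues_le m) ?_
    refine (card_roots_iterate_derivative_rodrigues (Nat.lt_succ_self m)).trans ?_
    exact (Multiset.toFinset_card_le _).trans (card_roots' _)
  have hwroot : ∀ y ∈ lglNodes (m + 1), w.eval y = 0 := by
    intro y hy
    rw [lglNodes_eq, Multiset.mem_toFinset, mem_roots hw0] at hy
    exact hy
  have hdiv : p = w * (p / w) + p % w := (EuclideanDomain.div_add_mod p w).symm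
  have hr : (p % w).natDegree ≤ m + 1 := by
    have := natDegree_mod_lt p (q := w) (by omega)
    omega
  have hq : derivative^[m] (p / w) = 0 := by
    by_cases h : p / w = 0
    · rw [h, iterate_derivative_zero]
    · refine iterate_derivative_eq_zero ?_
      have h1 : (w * (p / w)).natDegree ≤ max p.natDegree (p % w).natDegree := by
        rw [eq_sub_of_add_eq hdiv.symm]
        exact natDegree_sub_le _ _
      rw [natDegree_mul hw0 h, le_max_iff] at h1
      omega
  have hval : ∀ y ∈ lglNodes (m + 1), p.eval y = (p % w).eval y := by
    intro y hy
    conv_lhs => rw [hdiv]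
    rw [eval_add, eval_mul, hwroot y hy]
    ring
  have hint : ∫ x in (-1 : ℝ)..1, p.eval x = ∫ x in (-1 : ℝ)..1, (p % w).eval x := by
    conv_lhs => rw [hdiv]
    rw [integral_eval_add, integral_nodal_mul_eq_zero hq, zero_add]
  rw [hint]
  conv_rhs => rw [eq_sum_cardinal hn hr]
  rw [integral_eval_sum]
  refine Finset.sum_congr rfl fun y hy => ?_
  rw [integral_eval_C_mul, hval y hy, lglWeight]
  ring

/-- The weights are positive: the formula is exact for the square of the product of the `X - z` over
the interior nodes `z ≠ y`, times the factor among `1 + X`, `1 - X`, `1 - X ^ 2` that vanishes at the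
endpoints other than `y`; this nonnegative polynomial vanishes at all the nodes but `y`. -/
theorem lglWeight_pos {n : ℕ} (hn : 1 ≤ n) {y : ℝ} (hy : y ∈ lglNodes n) : 0 < lglWeight n y := by
  have h1 := endpoint_mem_lglNodes hn (one_pow 2)
  have h2 := endpoint_mem_lglNodes hn (by norm_num : (-1 : ℝ) ^ 2 = 1)
  have hyI := mem_Icc_of_mem_lglNodes hn hy
  set S := ((lglNodes n).erase y \ {1, -1}) with hS
  obtain ⟨ε, hdeg, hnn, hpos, hz⟩ : ∃ ε : ℝ[X], 2 * S.card + ε.natDegree ≤ 2 * n - 1 ∧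
      (∀ x ∈ Set.Icc (-1 : ℝ) 1, 0 ≤ ε.eval x) ∧ 0 < ε.eval y ∧
      ∀ z ∈ lglNodes n, z ≠ y → z ∉ S → ε.eval z = 0 := by
    have hz' : ∀ z ∈ lglNodes n, z ≠ y → z ∉ S → z = 1 ∨ z = -1 := by
      intro z hz hzy hzS
      by_contra h
      push Not at h
      exact hzS (by simp [hS, hz, hzy, h])
    have hcard := card_lglNodes hn
    have hce : ((lglNodes n).erase y).card = n := by rw [Finset.card_erase_of_mem hy, hcard]; rfl
    by_cases hy1 : y = 1
    · have hc : S.card + 1 ≤ n := by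
        rw [← hce]
        refine Finset.card_lt_card ⟨Finset.sdiff_subset, fun h => ?_⟩
        have := h (Finset.mem_erase.2 ⟨by norm_num [hy1], h2⟩)
        simp [hS] at this
      refine ⟨X + 1, ?_, ?_, ?_, ?_⟩
      · have : (X + 1 : ℝ[X]).natDegree ≤ 1 := by compute_degree
        omega
      · intro x hx
        simpa using (by linarith [hx.1] : 0 ≤ x + 1)
      · norm_num [hy1]
      · intro z hz hzy hzS
        rcases hz' z hz hzy hzS with h | h
        · exact absurd (h.trans hy1.symm) hzy
        · simp [h]
    by_cases hy2 : y = -1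
    · have hc : S.card + 1 ≤ n := by
        rw [← hce]
        refine Finset.card_lt_card ⟨Finset.sdiff_subset, fun h => ?_⟩
        have := h (Finset.mem_erase.2 ⟨by norm_num [hy2], h1⟩)
        simp [hS] at this
      refine ⟨1 - X, ?_, ?_, ?_, ?_⟩
      · have : (1 - X : ℝ[X]).natDegree ≤ 1 := by compute_degree
        omega
      · intro x hx
        simpa using hx.2
      · norm_num [hy2]
      · intro z hz hzy hzS
        rcases hz' z hz hzy hzS with h | h
        · simp [h]
        · exact absurd (h.trans hy2.symm) hzy
    · have hc : S.card + 2 = n := by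
        have h3 : ({1, -1} : Finset ℝ) ⊆ (lglNodes n).erase y := by
          intro z hz
          simp only [Finset.mem_insert, Finset.mem_singleton] at hz
          rcases hz with rfl | rfl
          · exact Finset.mem_erase.2 ⟨fun h => hy1 h.symm, h1⟩
          · exact Finset.mem_erase.2 ⟨fun h => hy2 h.symm, h2⟩
        have h4 := Finset.card_sdiff_add_card_eq_card h3
        rwa [Finset.card_pair (by norm_num), hce] at h4
      refine ⟨1 - X ^ 2, ?_, ?_, ?_, ?_⟩
      · have : (1 - X ^ 2 : ℝ[X]).natDegree ≤ 2 := by compute_degree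
        omega
      · intro x hx
        simp only [eval_sub, eval_one, eval_pow, eval_X]
        nlinarith [hx.1, hx.2]
      · simp only [eval_sub, eval_one, eval_pow, eval_X]
        have h3 : 0 < 1 - y := sub_pos.2 (lt_of_le_of_ne hyI.2 hy1)
        have h4 : 0 < 1 + y := by
          have := lt_of_le_of_ne hyI.1 (Ne.symm hy2)
          linarith
        nlinarith [mul_pos h3 h4]
      · intro z hz hzy hzS
        rcases hz' z hz hzy hzS with h | h <;> simp [h]
  set p := (Lagrange.nodal S id) ^ 2 * ε with hp
  have hpdeg : p.natDegree ≤ 2 * n - 1 := by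
    refine natDegree_mul_le.trans ?_
    have := natDegree_pow_le (p := Lagrange.nodal S (id : ℝ → ℝ)) (n := 2)
    rw [Lagrange.natDegree_nodal] at this
    omega
  have hpy : 0 < p.eval y := by
    rw [hp, eval_mul, eval_pow]
    refine mul_pos (sq_pos_of_ne_zero ?_) hpos
    refine Lagrange.eval_nodal_not_at_node ?_
    rintro i hi rfl
    simp [hS] at hi
  have hsum := sum_lglWeight_mul_eval hn hpdeg
  rw [Finset.sum_eq_single_of_mem y hy] at hsum
  · have h0 : 0 < ∫ x in (-1 : ℝ)..1, p.eval x := by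
      refine integral_eval_pos (by rintro h; simp [h] at hpy) fun x hx => ?_
      rw [hp, eval_mul, eval_pow]
      exact mul_nonneg (sq_nonneg _) (hnn x hx)
    rw [← hsum] at h0
    exact pos_of_mul_pos_left h0 hpy.le
  · intro z hz' hzy
    have : p.eval z = 0 := by
      rw [hp, eval_mul, eval_pow]
      by_cases hzS : z ∈ S
      · have := Lagrange.eval_nodal_at_node (v := (id : ℝ → ℝ)) hzS
        rw [id] at this
        rw [this]
        ring
      · rw [hz z hz' hzy hzS, mul_zero]
    rw [this, mul_zero]

/-! ### Discrete integration by parts -/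

theorem natDegree_derivative_le_sub_one {p : ℝ[X]} {n : ℕ} (hp : p.natDegree ≤ n) :
    (derivative p).natDegree ≤ n - 1 :=
  (natDegree_derivative_le p).trans (Nat.sub_le_sub_right hp 1)

theorem sum_lglWeight_derivative_mul {n : ℕ} (hn : 1 ≤ n) {p q : ℝ[X]} (hp : p.natDegree ≤ n)
    (hq : q.natDegree ≤ n) (hq1 : q.eval 1 = 0) (hq2 : q.eval (-1) = 0) :
    ∑ y ∈ lglNodes n, lglWeight n y * ((derivative p).eval y * q.eval y) =
      -∑ y ∈ lglNodes n, lglWeight n y * (p.eval y * (derivative q).eval y) := by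
  have hp' := natDegree_derivative_le_sub_one hp
  have hq' := natDegree_derivative_le_sub_one hq
  simp only [← eval_mul]
  rw [sum_lglWeight_mul_eval hn (natDegree_mul_le.trans (by omega)),
    sum_lglWeight_mul_eval hn (natDegree_mul_le.trans (by omega)), integral_eval_derivative_mul,
    eval_mul, eval_mul, hq1, hq2]
  ring

/-- The collocated second derivative with Dirichlet conditions is symmetric for the discrete inner
product. -/
theorem sum_lglWeight_derivative_derivative_comm {n : ℕ} (hn : 1 ≤ n) {p q : ℝ[X]}
    (hp : p.natDegree ≤ n) (hp1 : p.eval 1 = 0) (hp2 : p.eval (-1) = 0)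
    (hq : q.natDegree ≤ n) (hq1 : q.eval 1 = 0) (hq2 : q.eval (-1) = 0) :
    ∑ y ∈ lglNodes n, lglWeight n y * ((derivative (derivative p)).eval y * q.eval y) =
      ∑ y ∈ lglNodes n, lglWeight n y * (p.eval y * (derivative (derivative q)).eval y) := by
  have h1 := sum_lglWeight_derivative_mul hn
    ((natDegree_derivative_le_sub_one hp).trans (Nat.sub_le n 1)) hq hq1 hq2
  have h2 := sum_lglWeight_derivative_mul hn
    ((natDegree_derivative_le_sub_one hq).trans (Nat.sub_le n 1)) hp hp1 hp2
  rw [h1, Finset.sum_congr rfl fun y _ => by rw [mul_comm ((derivative p).eval y)], ← h2]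
  exact Finset.sum_congr rfl fun y _ => by rw [mul_comm (p.eval y)]

theorem sum_lglWeight_derivative_derivative_mul_self {n : ℕ} (hn : 1 ≤ n) {p : ℝ[X]}
    (hp : p.natDegree ≤ n) (hp1 : p.eval 1 = 0) (hp2 : p.eval (-1) = 0) :
    ∑ y ∈ lglNodes n, lglWeight n y * ((derivative (derivative p)).eval y * p.eval y) =
      -∫ x in (-1 : ℝ)..1, (derivative p ^ 2).eval x := by
  have hp' := natDegree_derivative_le_sub_one hp
  have h := natDegree_pow_le_of_le 2 hp'
  rw [sum_lglWeight_derivative_mul hn (hp'.trans (Nat.sub_le n 1)) hp hp1 hp2,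
    ← sum_lglWeight_mul_eval hn (p := derivative p ^ 2) (by omega)]
  simp only [eval_mul, sq]

theorem sum_lglWeight_derivative_derivative_mul_self_nonpos {n : ℕ} (hn : 1 ≤ n) {p : ℝ[X]}
    (hp : p.natDegree ≤ n) (hp1 : p.eval 1 = 0) (hp2 : p.eval (-1) = 0) :
    ∑ y ∈ lglNodes n, lglWeight n y * ((derivative (derivative p)).eval y * p.eval y) ≤ 0 := by
  rw [sum_lglWeight_derivative_derivative_mul_self hn hp hp1 hp2, neg_nonpos]
  refine intervalIntegral.integral_nonneg (by norm_num) fun x _ => ?_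
  rw [eval_pow]
  positivity

theorem eq_zero_of_sum_lglWeight_derivative_derivative_mul_self {n : ℕ} (hn : 1 ≤ n) {p : ℝ[X]}
    (hp : p.natDegree ≤ n) (hp1 : p.eval 1 = 0) (hp2 : p.eval (-1) = 0)
    (h : ∑ y ∈ lglNodes n, lglWeight n y * ((derivative (derivative p)).eval y * p.eval y) = 0) :
    p = 0 := by
  rw [sum_lglWeight_derivative_derivative_mul_self hn hp hp1 hp2, neg_eq_zero] at h
  have hd : derivative p = 0 := by
    by_contra hne
    refine (integral_eval_pos (pow_ne_zero 2 hne) fun x _ => ?_).ne' h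
    rw [eval_pow]
    positivity
  rw [eq_C_of_derivative_eq_zero hd, eval_C] at hp1
  rw [eq_C_of_derivative_eq_zero hd, hp1, C_0]

/-! ### The profiles of the artificial controls -/

theorem eval_lift {n : ℕ} {e y : ℝ} (hy : y ∈ lglNodes n) :
    (lift n e).eval y = if y = -1 ∨ y = 1 then 0 else (1 + e * y) / 2 :=
  Lagrange.eval_interpolate_at_node _ (injOn_id_lglNodes n) hy

theorem natDegree_lift_le {n : ℕ} (hn : 1 ≤ n) (e : ℝ) : (lift n e).natDegree ≤ n := by
  refine natDegree_le_of_degree_le ?_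
  refine (Lagrange.degree_interpolate_le _ (injOn_id_lglNodes n)).trans ?_
  rw [card_lglNodes hn]
  rfl

/-- The function that the artificial control at the endpoint `e` observes: the two terms of the
profile contribute `e q'(e) - ω q''(e)` and `-e q'(e)`, so that only the second derivative of `q` at
the endpoint is left. -/
theorem sum_lglWeight_profile_mul {n : ℕ} (hn : 1 ≤ n) {e : ℝ} (he : e = 1 ∨ e = -1) {q : ℝ[X]}
    (hq : q.natDegree ≤ n) (hq1 : q.eval 1 = 0) (hq2 : q.eval (-1) = 0) :
    ∑ y ∈ lglNodes n, lglWeight n y * ((profile n e).eval y * q.eval y) =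
      -(√(lglWeight n e) * (derivative (derivative q)).eval e) := by
  have he2 : e ^ 2 = 1 := by rcases he with rfl | rfl <;> norm_num
  have heS := endpoint_mem_lglNodes hn he2
  have hω := lglWeight_pos hn heS
  have hq' := natDegree_derivative_le_sub_one hq
  have hq'' := natDegree_derivative_le_sub_one hq'
  have h1S := endpoint_mem_lglNodes hn (one_pow 2)
  have h2S := endpoint_mem_lglNodes hn (by norm_num : (-1 : ℝ) ^ 2 = 1)
  -- the contribution of the derivative of the cardinal polynomial
  have hΨ : ∑ y ∈ lglNodes n, lglWeight n y * ((derivative (cardinal n e)).eval y * q.eval y) =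
      -(lglWeight n e * (derivative q).eval e) := by
    rw [sum_lglWeight_derivative_mul hn (natDegree_cardinal hn heS).le hq hq1 hq2,
      Finset.sum_eq_single_of_mem e heS, eval_cardinal_self heS, one_mul]
    intro z hz hze
    rw [eval_cardinal_of_ne hze.symm hz]
    ring
  -- the contribution of the lifting, compared with the affine function `(1 + e x) / 2`
  have hh : ∑ y ∈ lglNodes n, lglWeight n y *
      ((derivative (derivative (lift n e))).eval y * q.eval y) =
      e * (derivative q).eval e - lglWeight n e * (derivative (derivative q)).eval e := by
    rw [sum_lglWeight_derivative_derivative_comm hn (natDegree_lift_le hn e)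
      (by rw [eval_lift h1S]; simp) (by rw [eval_lift h2S]; simp) hq hq1 hq2]
    obtain ⟨a, hadeg, hev, hda⟩ : ∃ a : ℝ[X], a.natDegree ≤ 1 ∧
        (∀ x, a.eval x = (1 + e * x) / 2) ∧ derivative a = C (e / 2) := by
      refine ⟨C (1 / 2) * (1 + C e * X), by compute_degree, fun x => ?_, ?_⟩
      · simp only [eval_mul, eval_add, eval_C, eval_one, eval_X]
        ring
      · simp only [derivative_mul, derivative_add, derivative_C, derivative_one, derivative_X,
          zero_mul, zero_add, mul_one, ← C_mul]
        congr 1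
        ring
    have hquad := sum_lglWeight_mul_eval hn (p := derivative (derivative q) * a)
      (natDegree_mul_le.trans (by omega))
    rw [integral_eval_derivative_mul, hda, mul_comm (derivative q) (C (e / 2)),
      integral_eval_C_mul, integral_eval_derivative, hq1, hq2, eval_mul, eval_mul, hev, hev] at hquad
    have hdiff : ∑ y ∈ lglNodes n, (lglWeight n y * (derivative (derivative q) * a).eval y -
        lglWeight n y * ((lift n e).eval y * (derivative (derivative q)).eval y)) =
        lglWeight n e * (derivative (derivative q)).eval e := by
      rw [Finset.sum_eq_single_of_mem e heS]
      · rw [eval_lift heS, if_pos he.symm, eval_mul, hev]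
        linear_combination (lglWeight n e * (derivative (derivative q)).eval e) / 2 * he2
      · intro z hz hze
        rw [eval_lift hz, eval_mul, hev]
        split_ifs with h
        · have : 1 + e * z = 0 := by
            rcases he with rfl | rfl <;> rcases h with rfl | rfl <;> simp_all
          rw [this]
          ring
        · ring
    rw [Finset.sum_sub_distrib, hquad] at hdiff
    rcases he with rfl | rfl <;> linarith
  have hs : √(lglWeight n e) ^ 2 = lglWeight n e := Real.sq_sqrt hω.le
  have hs0 : √(lglWeight n e) ≠ 0 := (Real.sqrt_pos.2 hω).ne'
  have hsplit : ∑ y ∈ lglNodes n, lglWeight n y * ((profile n e).eval y * q.eval y) =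
      1 / √(lglWeight n e) * (∑ y ∈ lglNodes n, lglWeight n y *
        ((derivative (derivative (lift n e))).eval y * q.eval y)) +
      e / (√(lglWeight n e) * lglWeight n e) * (∑ y ∈ lglNodes n, lglWeight n y *
        ((derivative (cardinal n e)).eval y * q.eval y)) := by
    rw [Finset.mul_sum, Finset.mul_sum, ← Finset.sum_add_distrib]
    refine Finset.sum_congr rfl fun y _ => ?_
    simp only [profile, eval_add, eval_mul, eval_C, Function.iterate_succ_apply',
      Function.iterate_zero_apply]
    ring
  rw [hsplit, hΨ, hh]
  have hω0 := hω.ne'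
  field_simp
  linear_combination (derivative (derivative q)).eval e * hs

end Collocation

namespace Collocation

open MvPolynomial

/-! ### Restriction of a polynomial to a line parallel to an axis -/

/-- The restriction of a polynomial to the line through `x` parallel to the axis `i`, as a
polynomial in the coordinate `i`. -/
noncomputable def slice (i : Fin 2) (x : Fin 2 → ℝ) : MvPolynomial (Fin 2) ℝ →ₐ[ℝ] Polynomial ℝ :=
  aeval fun j => if j = i then Polynomial.X else Polynomial.C (x j)

theorem eval_slice (i : Fin 2) (x : Fin 2 → ℝ) (t : ℝ) (p : MvPolynomial (Fin 2) ℝ) :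
    (slice i x p).eval t = eval (Function.update x i t) p := by
  induction p using MvPolynomial.induction_on with
  | C a => simp [slice]
  | add p q hp hq => simp [hp, hq]
  | mul_X p j hp =>
    rw [map_mul, Polynomial.eval_mul, hp, map_mul, eval_X, slice, aeval_X]
    by_cases h : j = i
    · subst h
      simp
    · simp [h]

theorem derivative_slice (i : Fin 2) (x : Fin 2 → ℝ) (p : MvPolynomial (Fin 2) ℝ) :
    Polynomial.derivative (slice i x p) = slice i x (pderiv i p) := by
  induction p using MvPolynomial.induction_on with
  | C a => simp [slice]
  | add p q hp hq => simp [hp, hq]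
  | mul_X p j hp =>
    rw [map_mul, Polynomial.derivative_mul, hp, Derivation.leibniz, map_add, smul_eq_mul,
      smul_eq_mul, map_mul, map_mul]
    by_cases h : j = i
    · subst h
      simp [slice]
      ring
    · rw [pderiv_X_of_ne h]
      simp [slice, h]
      ring

theorem natDegree_slice_le (i : Fin 2) (x : Fin 2 → ℝ) (p : MvPolynomial (Fin 2) ℝ) :
    (slice i x p).natDegree ≤ p.degreeOf i := by
  rw [p.as_sum, map_sum, ← p.as_sum]
  refine Polynomial.natDegree_sum_le_of_forall_le _ _ fun m hm => ?_
  refine le_trans ?_ (monomial_le_degreeOf i hm)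
  rw [slice, aeval_monomial, Finsupp.prod_fintype _ _ (by simp)]
  refine (Polynomial.natDegree_C_mul_le _ _).trans ((Polynomial.natDegree_prod_le _ _).trans ?_)
  refine (Finset.sum_le_sum (g := fun j => if j = i then m i else 0) fun j _ => ?_).trans_eq (by simp)
  by_cases h : j = i
  · subst h
    simp
  · simp only [h, if_false]
    rw [← Polynomial.C_pow, Polynomial.natDegree_C]

theorem eval_derivative_derivative_slice (i : Fin 2) (x : Fin 2 → ℝ) (t : ℝ)
    (p : MvPolynomial (Fin 2) ℝ) :
    (Polynomial.derivative (Polynomial.derivative (slice i x p))).eval t =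
      eval (Function.update x i t) (pderiv i (pderiv i p)) := by
  rw [derivative_slice, derivative_slice, eval_slice]

/-! ### The polynomial space and the Laplacian -/

theorem degreeOf_pderiv_le (i j : Fin 2) (p : MvPolynomial (Fin 2) ℝ) :
    (pderiv j p).degreeOf i ≤ p.degreeOf i := by
  rw [degreeOf_le_iff]
  intro m hm
  rw [mem_support_iff, coeff_pderiv] at hm
  have := monomial_le_degreeOf i (mem_support_iff.2 (left_ne_zero_of_mul hm))
  rw [Finsupp.add_apply] at this
  omega

theorem add_mem_polySpace {N : Fin 2 → ℕ} {p q : MvPolynomial (Fin 2) ℝ} (hp : p ∈ polySpace N)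
    (hq : q ∈ polySpace N) : p + q ∈ polySpace N := fun i =>
  (degreeOf_add_le i p q).trans (max_le (hp i) (hq i))

theorem laplacian_eq (p : MvPolynomial (Fin 2) ℝ) :
    laplacian p = pderiv 0 (pderiv 0 p) + pderiv 1 (pderiv 1 p) := Fin.sum_univ_two _

theorem laplacian_mem_polySpace {N : Fin 2 → ℕ} {p : MvPolynomial (Fin 2) ℝ}
    (hp : p ∈ polySpace N) : laplacian p ∈ polySpace N := by
  rw [laplacian_eq]
  exact add_mem_polySpace
    (fun i => (degreeOf_pderiv_le i _ _).trans ((degreeOf_pderiv_le i _ _).trans (hp i)))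
    (fun i => (degreeOf_pderiv_le i _ _).trans ((degreeOf_pderiv_le i _ _).trans (hp i)))

/-- The Laplacian as a linear map. -/
noncomputable def laplacianLinear : MvPolynomial (Fin 2) ℝ →ₗ[ℝ] MvPolynomial (Fin 2) ℝ :=
  ∑ i, (pderiv i).toLinearMap ∘ₗ (pderiv i).toLinearMap

theorem laplacianLinear_apply (p : MvPolynomial (Fin 2) ℝ) : laplacianLinear p = laplacian p := by
  simp [laplacianLinear, laplacian]

/-- The Laplacian lowers the total degree. -/
theorem coeff_laplacian_eq_zero {d : ℕ} {p : MvPolynomial (Fin 2) ℝ}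
    (hp : ∀ m, coeff m p ≠ 0 → m 0 + m 1 < d + 1) :
    ∀ m, coeff m (laplacian p) ≠ 0 → m 0 + m 1 < d := by
  intro m hm
  rw [laplacian_eq, coeff_add, coeff_pderiv, coeff_pderiv, coeff_pderiv, coeff_pderiv] at hm
  by_contra hd
  refine hm ?_
  have h : ∀ i : Fin 2, coeff (m + Finsupp.single i 1 + Finsupp.single i 1) p = 0 := by
    intro i
    by_contra h
    have := hp _ h
    fin_cases i <;> simp at this <;> omega
  rw [h, h]
  ring

/-! ### The tensor grid -/

/-- The collocation nodes, as a finite set. -/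
noncomputable def gridFinset (N : Fin 2 → ℕ) : Finset (Fin 2 → ℝ) :=
  Fintype.piFinset fun i => lglNodes (N i)

theorem mem_gridFinset {N : Fin 2 → ℕ} {x : Fin 2 → ℝ} :
    x ∈ gridFinset N ↔ ∀ i, x i ∈ lglNodes (N i) := Fintype.mem_piFinset

/-- The collocation nodes of the open square, as a finite set. -/
noncomputable def interiorFinset (N : Fin 2 → ℕ) : Finset (Fin 2 → ℝ) :=
  (gridFinset N).filter fun x => ∀ i, -1 < x i ∧ x i < 1

theorem mem_interiorFinset {N : Fin 2 → ℕ} {x : Fin 2 → ℝ} :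
    x ∈ interiorFinset N ↔ x ∈ interiorGrid N := by
  rw [interiorFinset, Finset.mem_filter, mem_gridFinset]
  rfl

/-- The weight of a node of the tensor grid. -/
noncomputable def gridWeight (N : Fin 2 → ℕ) (x : Fin 2 → ℝ) : ℝ :=
  ∏ i, lglWeight (N i) (x i)

theorem gridWeight_pos {N : Fin 2 → ℕ} (hN : ∀ i, 1 ≤ N i) {x : Fin 2 → ℝ}
    (hx : x ∈ gridFinset N) : 0 < gridWeight N x :=
  Finset.prod_pos fun i _ => lglWeight_pos (hN i) (mem_gridFinset.1 hx i)

theorem eq_of_ne_of_ne {i j k : Fin 2} (hij : i ≠ j) (hk : k ≠ i) : k = j := by omega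

theorem update_mem_gridFinset {N : Fin 2 → ℕ} {i j : Fin 2} (hij : i ≠ j) {a b : ℝ}
    (ha : a ∈ lglNodes (N i)) (hb : b ∈ lglNodes (N j)) :
    Function.update (fun _ => b) i a ∈ gridFinset N := by
  rw [mem_gridFinset]
  intro k
  by_cases hk : k = i
  · subst hk
    simpa using ha
  · rw [Function.update_of_ne hk, eq_of_ne_of_ne hij hk]
    exact hb

theorem update_const_eq {i j : Fin 2} (hij : i ≠ j) (x : Fin 2 → ℝ) :
    Function.update (fun _ => x j) i (x i) = x := by
  ext k
  by_cases hk : k = i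
  · subst hk
    simp
  · rw [Function.update_of_ne hk, eq_of_ne_of_ne hij hk]

/-- Summation over the tensor grid along the lines parallel to the axis `i`. -/
theorem sum_gridFinset {N : Fin 2 → ℕ} {i j : Fin 2} (hij : i ≠ j) (F : (Fin 2 → ℝ) → ℝ) :
    ∑ x ∈ gridFinset N, F x =
      ∑ b ∈ lglNodes (N j), ∑ a ∈ lglNodes (N i), F (Function.update (fun _ => b) i a) := by
  rw [← Finset.sum_product']
  refine Finset.sum_bij' (fun x _ => (x j, x i)) (fun q _ => Function.update (fun _ => q.1) i q.2)
    (fun x hx => ?_) (fun q hq => ?_) (fun x _ => update_const_eq hij x) (fun q _ => ?_)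
    (fun x _ => by rw [update_const_eq hij])
  · rw [mem_gridFinset] at hx
    exact Finset.mem_product.2 ⟨hx j, hx i⟩
  · rw [Finset.mem_product] at hq
    exact update_mem_gridFinset hij hq.2 hq.1
  · simp [Function.update_of_ne hij.symm]

theorem gridWeight_update {N : Fin 2 → ℕ} {i j : Fin 2} (hij : i ≠ j) (a b : ℝ) :
    gridWeight N (Function.update (fun _ => b) i a) = lglWeight (N j) b * lglWeight (N i) a := by
  rw [gridWeight, Fin.prod_univ_two]
  fin_cases i <;> fin_cases j <;> simp_all [mul_comm]

/-- A polynomial of the space that vanishes at all the nodes is zero. -/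
theorem eq_zero_of_eval_gridFinset {N : Fin 2 → ℕ} (hN : ∀ i, 1 ≤ N i)
    {p : MvPolynomial (Fin 2) ℝ} (hp : p ∈ polySpace N) (h : ∀ x ∈ gridFinset N, eval x p = 0) :
    p = 0 := by
  refine eq_zero_of_eval_zero_at_prod_finset p (fun i => lglNodes (N i)) (fun i => ?_)
    fun x hx => h x (mem_gridFinset.2 hx)
  rw [card_lglNodes (hN i)]
  exact Nat.lt_succ_of_le (hp i)

/-! ### Interpolation on the grid -/

/-- The Lagrange polynomial of the node `x` of the tensor grid. -/
noncomputable def gridCardinal (N : Fin 2 → ℕ) (x : Fin 2 → ℝ) : MvPolynomial (Fin 2) ℝ :=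
  ∏ i, (cardinal (N i) (x i)).toMvPolynomial i

/-- The polynomial of the space `polySpace N` with given values at the nodes. -/
noncomputable def gridInterp (N : Fin 2 → ℕ) :
    ((Fin 2 → ℝ) → ℝ) →ₗ[ℝ] MvPolynomial (Fin 2) ℝ :=
  ∑ x ∈ gridFinset N, (LinearMap.proj x).smulRight (gridCardinal N x)

theorem gridInterp_apply (N : Fin 2 → ℕ) (F : (Fin 2 → ℝ) → ℝ) :
    gridInterp N F = ∑ x ∈ gridFinset N, F x • gridCardinal N x := by
  simp [gridInterp]

theorem eval_gridCardinal (N : Fin 2 → ℕ) (x z : Fin 2 → ℝ) :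
    eval z (gridCardinal N x) = ∏ i, (cardinal (N i) (x i)).eval (z i) := by
  rw [gridCardinal, map_prod]
  exact Finset.prod_congr rfl fun i _ => eval_toMvPolynomial _ _ _

theorem eval_gridInterp {N : Fin 2 → ℕ} {F : (Fin 2 → ℝ) → ℝ} {z : Fin 2 → ℝ}
    (hz : z ∈ gridFinset N) : eval z (gridInterp N F) = F z := by
  rw [gridInterp_apply, map_sum, Finset.sum_eq_single_of_mem z hz]
  · rw [smul_eval, eval_gridCardinal, Finset.prod_eq_one, mul_one]
    exact fun i _ => eval_cardinal_self (mem_gridFinset.1 hz i)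
  · intro x hx hxz
    obtain ⟨i, hi⟩ := Function.ne_iff.1 hxz
    rw [smul_eval, eval_gridCardinal, Finset.prod_eq_zero (Finset.mem_univ i), mul_zero]
    exact eval_cardinal_of_ne hi (mem_gridFinset.1 hz i)

theorem degreeOf_toMvPolynomial_le (i j : Fin 2) (p : Polynomial ℝ) :
    (p.toMvPolynomial j).degreeOf i ≤ if i = j then p.natDegree else 0 := by
  have hp : p.toMvPolynomial j = ∑ k ∈ Finset.range (p.natDegree + 1), C (p.coeff k) * X j ^ k := by
    conv_lhs => rw [p.as_sum_range_C_mul_X_pow]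
    simp only [map_sum, map_mul, map_pow, Polynomial.toMvPolynomial_C,
      Polynomial.toMvPolynomial_X]
  rw [hp]
  refine (degreeOf_sum_le i _ _).trans (Finset.sup_le fun k hk => ?_)
  refine (degreeOf_C_mul_le _ _ _).trans ?_
  rw [Finset.mem_range] at hk
  split_ifs with h
  · subst h
    rw [degreeOf_X_self_pow]
    omega
  · rw [degreeOf_X_pow_of_ne _ h]

theorem gridInterp_mem_polySpace {N : Fin 2 → ℕ} (hN : ∀ i, 1 ≤ N i) (F : (Fin 2 → ℝ) → ℝ) :
    gridInterp N F ∈ polySpace N := by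
  intro i
  rw [gridInterp_apply]
  refine (degreeOf_sum_le i _ _).trans (Finset.sup_le fun x hx => ?_)
  rw [smul_eq_C_mul]
  refine (degreeOf_C_mul_le _ _ _).trans ((degreeOf_prod_le _ _ _).trans ?_)
  refine (Finset.sum_le_sum (g := fun j => if i = j then N i else 0) fun j _ => ?_).trans_eq
    (by simp)
  refine (degreeOf_toMvPolynomial_le i j _).trans ?_
  split_ifs with h
  · subst h
    exact (natDegree_cardinal (hN i) (mem_gridFinset.1 hx i)).le
  · exact le_rfl

theorem gridInterp_eval {N : Fin 2 → ℕ} (hN : ∀ i, 1 ≤ N i) {p : MvPolynomial (Fin 2) ℝ}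
    (hp : p ∈ polySpace N) {F : (Fin 2 → ℝ) → ℝ} (hF : ∀ x ∈ gridFinset N, eval x p = F x) :
    p = gridInterp N F := by
  rw [← sub_eq_zero]
  refine eq_zero_of_eval_gridFinset hN (fun i => ?_) fun x hx => ?_
  · rw [sub_eq_add_neg, ← neg_one_smul ℝ (gridInterp N F), ← map_smul]
    exact add_mem_polySpace hp (gridInterp_mem_polySpace hN _) i
  · rw [map_sub, eval_gridInterp hx, hF x hx, sub_self]

/-! ### The Laplacian of grid functions vanishing on the boundary -/

/-- Being zero at the nodes of the boundary of the square. -/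
def VanishesOnBoundaryGrid (N : Fin 2 → ℕ) (p : MvPolynomial (Fin 2) ℝ) : Prop :=
  ∀ x ∈ gridFinset N, x ∉ interiorFinset N → eval x p = 0

theorem exists_endpoint_of_notMem_interiorFinset {N : Fin 2 → ℕ} (hN : ∀ i, 1 ≤ N i)
    {x : Fin 2 → ℝ} (hx : x ∈ gridFinset N) (hx' : x ∉ interiorFinset N) :
    ∃ i, x i = 1 ∨ x i = -1 := by
  by_contra! h
  refine hx' (Finset.mem_filter.2 ⟨hx, fun i => ?_⟩)
  have := mem_Icc_of_mem_lglNodes (hN i) (mem_gridFinset.1 hx i)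
  exact ⟨lt_of_le_of_ne this.1 (h i).2.symm, lt_of_le_of_ne this.2 (h i).1⟩

theorem notMem_interiorFinset {N : Fin 2 → ℕ} {x : Fin 2 → ℝ} (i : Fin 2)
    (hi : x i = 1 ∨ x i = -1) : x ∉ interiorFinset N := by
  intro h
  have := (Finset.mem_filter.1 h).2 i
  rcases hi with hi | hi <;> rw [hi] at this
  · exact lt_irrefl _ this.2
  · exact lt_irrefl _ this.1

theorem sq_eq_one_of_endpoint {e : ℝ} (he : e = 1 ∨ e = -1) : e ^ 2 = 1 := by
  rcases he with rfl | rfl <;> norm_num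

section

variable {N : Fin 2 → ℕ} {p q : MvPolynomial (Fin 2) ℝ} {i j : Fin 2}

theorem VanishesOnBoundaryGrid.eval_slice (hN : ∀ i, 1 ≤ N i) (h : VanishesOnBoundaryGrid N p)
    (hij : i ≠ j) {b : ℝ} (hb : b ∈ lglNodes (N j)) {e : ℝ} (he : e = 1 ∨ e = -1) :
    (slice i (fun _ => b) p).eval e = 0 := by
  rw [Collocation.eval_slice]
  refine h _ (update_mem_gridFinset hij
    (endpoint_mem_lglNodes (hN i) (sq_eq_one_of_endpoint he)) hb) ?_
  exact notMem_interiorFinset i (by simpa using he)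

/-- A polynomial of the space that vanishes at the nodes of a side vanishes along this side. -/
theorem VanishesOnBoundaryGrid.slice_eq_zero (hN : ∀ i, 1 ≤ N i) (hp : p ∈ polySpace N)
    (h : VanishesOnBoundaryGrid N p) (hij : i ≠ j) {e : ℝ} (he : e = 1 ∨ e = -1) :
    slice i (fun _ => e) p = 0 := by
  refine Polynomial.eq_zero_of_degree_lt_of_eval_finset_eq_zero (lglNodes (N i)) ?_ fun a ha => ?_
  · rw [card_lglNodes (hN i)]
    refine Polynomial.degree_le_natDegree.trans_lt ?_
    exact_mod_cast Nat.lt_succ_of_le ((natDegree_slice_le i _ p).trans (hp i))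
  · rw [Collocation.eval_slice]
    refine h _ (update_mem_gridFinset hij ha
      (endpoint_mem_lglNodes (hN j) (sq_eq_one_of_endpoint he))) ?_
    exact notMem_interiorFinset j (by simpa [Function.update_of_ne hij.symm] using he)

/-- The discrete inner product with a second derivative, summed along lines. -/
theorem sum_gridWeight_pderiv_mul (hij : i ≠ j) :
    ∑ x ∈ gridFinset N, gridWeight N x * (eval x (pderiv i (pderiv i p)) * eval x q) =
      ∑ b ∈ lglNodes (N j), lglWeight (N j) b * ∑ a ∈ lglNodes (N i), lglWeight (N i) a *
        ((Polynomial.derivative (Polynomial.derivative (slice i (fun _ => b) p))).eval a *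
          (slice i (fun _ => b) q).eval a) := by
  rw [sum_gridFinset hij]
  refine Finset.sum_congr rfl fun b _ => ?_
  rw [Finset.mul_sum]
  refine Finset.sum_congr rfl fun a _ => ?_
  rw [gridWeight_update hij, eval_derivative_derivative_slice, eval_slice]
  ring

theorem sum_gridWeight_pderiv_comm (hN : ∀ i, 1 ≤ N i) (hp : p ∈ polySpace N)
    (hq : q ∈ polySpace N) (hp0 : VanishesOnBoundaryGrid N p) (hq0 : VanishesOnBoundaryGrid N q)
    (hij : i ≠ j) :
    ∑ x ∈ gridFinset N, gridWeight N x * (eval x (pderiv i (pderiv i p)) * eval x q) =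
      ∑ x ∈ gridFinset N, gridWeight N x * (eval x (pderiv i (pderiv i q)) * eval x p) := by
  rw [sum_gridWeight_pderiv_mul hij, sum_gridWeight_pderiv_mul hij]
  refine Finset.sum_congr rfl fun b hb => ?_
  rw [sum_lglWeight_derivative_derivative_comm (hN i) ((natDegree_slice_le i _ p).trans (hp i))
    (hp0.eval_slice hN hij hb (Or.inl rfl)) (hp0.eval_slice hN hij hb (Or.inr rfl))
    ((natDegree_slice_le i _ q).trans (hq i))
    (hq0.eval_slice hN hij hb (Or.inl rfl)) (hq0.eval_slice hN hij hb (Or.inr rfl))]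
  simp only [mul_comm]

theorem sum_gridWeight_laplacian_mul (p q : MvPolynomial (Fin 2) ℝ) :
    ∑ x ∈ gridFinset N, gridWeight N x * (eval x (laplacian p) * eval x q) =
      ∑ x ∈ gridFinset N, gridWeight N x * (eval x (pderiv 0 (pderiv 0 p)) * eval x q) +
      ∑ x ∈ gridFinset N, gridWeight N x * (eval x (pderiv 1 (pderiv 1 p)) * eval x q) := by
  rw [← Finset.sum_add_distrib]
  refine Finset.sum_congr rfl fun x _ => ?_
  rw [laplacian_eq, map_add]
  ring

/-- The collocated Dirichlet Laplacian is symmetric for the discrete inner product. -/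
theorem sum_gridWeight_laplacian_comm (hN : ∀ i, 1 ≤ N i) (hp : p ∈ polySpace N)
    (hq : q ∈ polySpace N) (hp0 : VanishesOnBoundaryGrid N p) (hq0 : VanishesOnBoundaryGrid N q) :
    ∑ x ∈ gridFinset N, gridWeight N x * (eval x (laplacian p) * eval x q) =
      ∑ x ∈ gridFinset N, gridWeight N x * (eval x (laplacian q) * eval x p) := by
  rw [sum_gridWeight_laplacian_mul, sum_gridWeight_laplacian_mul,
    sum_gridWeight_pderiv_comm hN hp hq hp0 hq0 zero_ne_one,
    sum_gridWeight_pderiv_comm hN hp hq hp0 hq0 one_ne_zero]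

theorem sum_gridWeight_pderiv_mul_self_nonpos (hN : ∀ i, 1 ≤ N i) (hp : p ∈ polySpace N)
    (hp0 : VanishesOnBoundaryGrid N p) (hij : i ≠ j) :
    ∑ x ∈ gridFinset N, gridWeight N x * (eval x (pderiv i (pderiv i p)) * eval x p) ≤ 0 := by
  rw [sum_gridWeight_pderiv_mul hij]
  refine Finset.sum_nonpos fun b hb => mul_nonpos_of_nonneg_of_nonpos
    (lglWeight_pos (hN j) hb).le ?_
  exact sum_lglWeight_derivative_derivative_mul_self_nonpos (hN i)
    ((natDegree_slice_le i _ p).trans (hp i))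
    (hp0.eval_slice hN hij hb (Or.inl rfl)) (hp0.eval_slice hN hij hb (Or.inr rfl))

/-- The collocated Dirichlet Laplacian is injective, being negative definite for the discrete inner
product. -/
theorem eq_zero_of_laplacian_eq_zero (hN : ∀ i, 1 ≤ N i) (hp : p ∈ polySpace N)
    (hp0 : VanishesOnBoundaryGrid N p) (h : laplacian p = 0) : p = 0 := by
  have h0 := sum_gridWeight_pderiv_mul_self_nonpos hN hp hp0 zero_ne_one
  have h1 := sum_gridWeight_pderiv_mul_self_nonpos hN hp hp0 one_ne_zero
  have h2 := sum_gridWeight_laplacian_mul (N := N) p p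
  simp only [h, map_zero, zero_mul, mul_zero, Finset.sum_const_zero] at h2
  have h3 : ∑ x ∈ gridFinset N,
      gridWeight N x * (eval x (pderiv 0 (pderiv 0 p)) * eval x p) = 0 := by linarith
  rw [sum_gridWeight_pderiv_mul zero_ne_one, Finset.sum_eq_zero_iff_of_nonpos] at h3
  · refine eq_zero_of_eval_gridFinset hN hp fun x hx => ?_
    rw [mem_gridFinset] at hx
    have h4 := (mul_eq_zero.1 (h3 _ (hx 1))).resolve_left (lglWeight_pos (hN 1) (hx 1)).ne'
    have h5 := eq_zero_of_sum_lglWeight_derivative_derivative_mul_self (hN 0)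
      ((natDegree_slice_le 0 _ p).trans (hp 0))
      (hp0.eval_slice hN zero_ne_one (hx 1) (Or.inl rfl))
      (hp0.eval_slice hN zero_ne_one (hx 1) (Or.inr rfl)) h4
    have h6 := Collocation.eval_slice 0 (fun _ => x 1) (x 0) p
    rw [h5, update_const_eq zero_ne_one, Polynomial.eval_zero] at h6
    exact h6.symm
  · intro b hb
    exact mul_nonpos_of_nonneg_of_nonpos (lglWeight_pos (hN 1) hb).le
      (sum_lglWeight_derivative_derivative_mul_self_nonpos (hN 0)
      ((natDegree_slice_le 0 _ p).trans (hp 0))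
      (hp0.eval_slice hN zero_ne_one hb (Or.inl rfl))
      (hp0.eval_slice hN zero_ne_one hb (Or.inr rfl)))

/-- If a polynomial vanishes at the nodes of the boundary, and its second normal derivatives too, so
does its Laplacian: the polynomial vanishes along the sides, hence so do its tangential
derivatives. -/
theorem VanishesOnBoundaryGrid.laplacian (hN : ∀ i, 1 ≤ N i) (hp : p ∈ polySpace N)
    (hp0 : VanishesOnBoundaryGrid N p)
    (hnn : ∀ i j : Fin 2, i ≠ j → ∀ b ∈ lglNodes (N j), ∀ e : ℝ,
      (e = 1 ∨ e = -1) → eval (Function.update (fun _ => b) i e) (pderiv i (pderiv i p)) = 0) :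
    VanishesOnBoundaryGrid N (laplacian p) := by
  intro x hx hx'
  obtain ⟨i, hi⟩ := exists_endpoint_of_notMem_interiorFinset hN hx hx'
  obtain ⟨j, hij⟩ : ∃ j, i ≠ j := ⟨1 - i, by omega⟩
  have ht : eval x (pderiv j (pderiv j p)) = 0 := by
    rw [← update_const_eq hij.symm x, ← eval_derivative_derivative_slice,
      hp0.slice_eq_zero hN hp hij.symm hi]
    simp
  have hn : eval x (pderiv i (pderiv i p)) = 0 := by
    have := hnn i j hij (x j) (mem_gridFinset.1 hx j) (x i) hi
    rwa [update_const_eq hij] at this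
  have hsum : Collocation.laplacian p = pderiv i (pderiv i p) + pderiv j (pderiv j p) := by
    rw [laplacian_eq]
    fin_cases i <;> fin_cases j <;> simp_all [add_comm]
  rw [hsum, map_add, hn, ht, add_zero]

end

/-! ### Observability through the artificial controls -/

/-- Values at the interior nodes, the state space of the collocation system. -/
abbrev InteriorValues (N : Fin 2 → ℕ) : Type := interiorFinset N → ℝ

/-- The function with the given values at the interior nodes and the value zero elsewhere. -/
noncomputable def extendByZero (N : Fin 2 → ℕ) : InteriorValues N →ₗ[ℝ] (Fin 2 → ℝ) → ℝ where
  toFun U x := if h : x ∈ interiorFinset N then U ⟨x, h⟩ else 0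
  map_add' U V := by
    ext x
    by_cases h : x ∈ interiorFinset N <;> simp [h]
  map_smul' c U := by
    ext x
    by_cases h : x ∈ interiorFinset N <;> simp [h]

theorem extendByZero_of_mem {N : Fin 2 → ℕ} (U : InteriorValues N) {x : Fin 2 → ℝ}
    (h : x ∈ interiorFinset N) : extendByZero N U x = U ⟨x, h⟩ := dif_pos h

theorem extendByZero_of_notMem {N : Fin 2 → ℕ} (U : InteriorValues N) {x : Fin 2 → ℝ}
    (h : x ∉ interiorFinset N) : extendByZero N U x = 0 := dif_neg h

/-- The values of the Laplacian of a polynomial at the interior nodes. -/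
noncomputable def interiorLaplacian (N : Fin 2 → ℕ) :
    MvPolynomial (Fin 2) ℝ →ₗ[ℝ] InteriorValues N :=
  LinearMap.pi fun x => (aeval x.1).toLinearMap ∘ₗ laplacianLinear

theorem interiorLaplacian_apply {N : Fin 2 → ℕ} (p : MvPolynomial (Fin 2) ℝ)
    (x : interiorFinset N) : interiorLaplacian N p x = eval x.1 (laplacian p) := by
  rw [interiorLaplacian, LinearMap.pi_apply, LinearMap.comp_apply, laplacianLinear_apply,
    AlgHom.toLinearMap_apply, aeval_eq_eval]

/-- The collocated Laplacian with homogeneous Dirichlet conditions. -/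
noncomputable def dirichletLaplacian (N : Fin 2 → ℕ) : InteriorValues N →ₗ[ℝ] InteriorValues N :=
  interiorLaplacian N ∘ₗ gridInterp N ∘ₗ extendByZero N

/-- The effect on the interior nodes of the artificial control at the node of tangential coordinate
`b` of the side `x i = e`, where `j` is the other coordinate. -/
noncomputable def artificialColumn (N : Fin 2 → ℕ) (i j : Fin 2) (e b : ℝ) : InteriorValues N :=
  fun x => if x.1 j = b then (profile (N i) e).eval (x.1 i) else 0

theorem vanishesOnBoundaryGrid_gridInterp {N : Fin 2 → ℕ} (U : InteriorValues N) :
    VanishesOnBoundaryGrid N (gridInterp N (extendByZero N U)) := by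
  intro x hx hx'
  rw [eval_gridInterp hx, extendByZero_of_notMem U hx']

/-- The discrete inner product of a polynomial with a function on the interior nodes. -/
noncomputable def pairing (N : Fin 2 → ℕ) (p : MvPolynomial (Fin 2) ℝ) (U : InteriorValues N) : ℝ :=
  ∑ x ∈ gridFinset N, gridWeight N x * (eval x p * extendByZero N U x)

section

variable {N : Fin 2 → ℕ} {p : MvPolynomial (Fin 2) ℝ}

theorem pairing_laplacian (hN : ∀ i, 1 ≤ N i) (hp : p ∈ polySpace N)
    (hp0 : VanishesOnBoundaryGrid N p) (U : InteriorValues N) :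
    pairing N (laplacian p) U = pairing N p (dirichletLaplacian N U) := by
  have h1 : pairing N (laplacian p) U = ∑ x ∈ gridFinset N, gridWeight N x *
      (eval x (laplacian p) * eval x (gridInterp N (extendByZero N U))) :=
    Finset.sum_congr rfl fun x hx => by rw [eval_gridInterp hx]
  rw [h1, sum_gridWeight_laplacian_comm hN hp (gridInterp_mem_polySpace hN _) hp0
    (vanishesOnBoundaryGrid_gridInterp U)]
  refine Finset.sum_congr rfl fun x hx => ?_
  by_cases h : x ∈ interiorFinset N
  · rw [extendByZero_of_mem _ h, dirichletLaplacian, LinearMap.comp_apply, interiorLaplacian_apply,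
      LinearMap.comp_apply]
    ring
  · rw [hp0 x hx h]
    ring

/-- The artificial controls observe the second normal derivative on the sides. -/
theorem pairing_artificialColumn (hN : ∀ i, 1 ≤ N i) (hp : p ∈ polySpace N)
    (hp0 : VanishesOnBoundaryGrid N p) {i j : Fin 2} (hij : i ≠ j) {b : ℝ}
    (hb : b ∈ lglNodes (N j)) {e : ℝ} (he : e = 1 ∨ e = -1) :
    pairing N p (artificialColumn N i j e b) = -(lglWeight (N j) b * (√(lglWeight (N i) e) *
      eval (Function.update (fun _ => b) i e) (pderiv i (pderiv i p)))) := by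
  rw [pairing, sum_gridFinset hij, Finset.sum_eq_single_of_mem b hb]
  · rw [← eval_derivative_derivative_slice, ← mul_neg, ← sum_lglWeight_profile_mul (hN i) he
      ((natDegree_slice_le i _ p).trans (hp i)) (hp0.eval_slice hN hij hb (Or.inl rfl))
      (hp0.eval_slice hN hij hb (Or.inr rfl)), Finset.mul_sum]
    refine Finset.sum_congr rfl fun a ha => ?_
    rw [gridWeight_update hij, eval_slice]
    by_cases h : Function.update (fun _ => b) i a ∈ interiorFinset N
    · rw [extendByZero_of_mem _ h, artificialColumn]
      simp only [Function.update_of_ne hij.symm, Function.update_self, if_true]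
      ring
    · rw [hp0 _ (update_mem_gridFinset hij ha hb) h]
      ring
  · intro b' hb' hne
    refine Finset.sum_eq_zero fun a ha => ?_
    by_cases h : Function.update (fun _ => b') i a ∈ interiorFinset N
    · rw [extendByZero_of_mem _ h, artificialColumn]
      simp [Function.update_of_ne hij.symm, hne]
    · rw [extendByZero_of_notMem _ h]
      ring

/-- The Kalman condition: a space of grid functions that is invariant under the collocated Laplacian
and contains the effects of all the artificial controls is everything.  On its annihilator the
Laplacian of polynomials acts, and it acts injectively, although it lowers the total degree. -/
theorem eq_top_of_artificialColumn_mem (hN : ∀ i, 1 ≤ N i) (R : Submodule ℝ (InteriorValues N))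
    (hA : ∀ U ∈ R, dirichletLaplacian N U ∈ R)
    (hB : ∀ i j : Fin 2, i ≠ j → ∀ e : ℝ, (e = 1 ∨ e = -1) → ∀ b ∈ lglNodes (N j),
      artificialColumn N i j e b ∈ R) : R = ⊤ := by
  have key : ∀ d : ℕ, ∀ p ∈ polySpace N, VanishesOnBoundaryGrid N p →
      (∀ U ∈ R, pairing N p U = 0) → (∀ m, coeff m p ≠ 0 → m 0 + m 1 < d) → p = 0 := by
    intro d
    induction d with
    | zero =>
      intro p _ _ _ hd
      ext m
      by_contra h
      exact absurd (hd m (by simpa using h)) (Nat.not_lt_zero _)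
    | succ d ih =>
      intro p hp hp0 hR hd
      refine eq_zero_of_laplacian_eq_zero hN hp hp0 (ih _ (laplacian_mem_polySpace hp)
        (hp0.laplacian hN hp fun i j hij b hb e he => ?_) (fun U hU => ?_)
        (coeff_laplacian_eq_zero hd))
      · have h := hR _ (hB i j hij e he b hb)
        rw [pairing_artificialColumn hN hp hp0 hij hb he, neg_eq_zero] at h
        refine ((mul_eq_zero.1 h).resolve_left (lglWeight_pos (hN j) hb).ne' |>
          mul_eq_zero.1).resolve_left ?_
        exact (Real.sqrt_pos.2 (lglWeight_pos (hN i)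
          (endpoint_mem_lglNodes (hN i) (sq_eq_one_of_endpoint he)))).ne'
      · rw [pairing_laplacian hN hp hp0]
        exact hR _ (hA U hU)
  by_contra hne
  obtain ⟨f, hf0, hf⟩ := Submodule.exists_le_ker_of_lt_top R (lt_top_iff_ne_top.2 hne)
  -- `f` is represented by `p` in the discrete inner product
  set G : InteriorValues N := fun x => f (Pi.single x 1) / gridWeight N x.1 with hG
  set p := gridInterp N (extendByZero N G) with hp
  have hwpos : ∀ x : interiorFinset N, gridWeight N x.1 ≠ 0 := fun x =>
    (gridWeight_pos hN (Finset.mem_filter.1 x.2).1).ne'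
  have hsub : interiorFinset N ⊆ gridFinset N := Finset.filter_subset _ _
  have hrep : ∀ U, pairing N p U = f U := by
    intro U
    rw [pairing, ← Finset.sum_subset hsub fun x _ hx => by
      rw [extendByZero_of_notMem _ hx, mul_zero, mul_zero], ← Finset.sum_coe_sort,
      LinearMap.pi_apply_eq_sum_univ f U]
    refine Finset.sum_congr rfl fun x _ => ?_
    rw [extendByZero_of_mem _ x.2, hp, eval_gridInterp (hsub x.2), extendByZero_of_mem _ x.2,
      smul_eq_mul]
    have hsingle : (fun y => if x = y then (1 : ℝ) else 0) = Pi.single x 1 := by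
      ext y
      simp [Pi.single_apply, eq_comm]
    rw [hsingle]
    simp only [hG]
    field_simp [hwpos x]
  have hp0 : p = 0 := by
    refine key (p.totalDegree + 1) p (gridInterp_mem_polySpace hN _)
      (vanishesOnBoundaryGrid_gridInterp G) (fun U hU => ?_) fun m hm => ?_
    · rw [hrep]
      exact hf hU
    · have := le_totalDegree (mem_support_iff.2 hm)
      rw [Finsupp.sum_fintype _ _ (by simp), Fin.sum_univ_two] at this
      omega
  refine hf0 (LinearMap.ext fun U => ?_)
  rw [← hrep, hp0]
  simp [pairing]

end

/-! ### Null controllability of second order linear systems -/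

/-- Smooth functions of time supported in the middle third of `(0, T)`. -/
structure IsMiddleBump {F : Type*} [NormedAddCommGroup F] [NormedSpace ℝ F] (T : ℝ) (f : ℝ → F) :
    Prop where
  contDiff : ContDiff ℝ ∞ f
  eq_zero : ∀ t, t < T / 3 ∨ 2 * T / 3 < t → f t = 0

namespace IsMiddleBump

variable {F : Type*} [NormedAddCommGroup F] [NormedSpace ℝ F] {T : ℝ} {f g : ℝ → F}

theorem zero : IsMiddleBump T (fun _ => (0 : F)) := ⟨contDiff_const, fun _ _ => rfl⟩

theorem add (hf : IsMiddleBump T f) (hg : IsMiddleBump T g) :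
    IsMiddleBump T (fun t => f t + g t) :=
  ⟨hf.contDiff.add hg.contDiff, fun t ht => by rw [hf.eq_zero t ht, hg.eq_zero t ht, add_zero]⟩

theorem smul_const {s : ℝ → ℝ} (hs : IsMiddleBump T s) (v : F) :
    IsMiddleBump T (fun t => s t • v) :=
  ⟨hs.contDiff.smul contDiff_const, fun t ht => by rw [hs.eq_zero t ht, zero_smul]⟩

theorem const_smul (hf : IsMiddleBump T f) (a : ℝ) : IsMiddleBump T (fun t => a • f t) :=
  ⟨contDiff_const.smul hf.contDiff, fun t ht => by rw [hf.eq_zero t ht, smul_zero]⟩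

theorem sum {ι : Type*} (s : Finset ι) {f : ι → ℝ → F} (hf : ∀ i ∈ s, IsMiddleBump T (f i)) :
    IsMiddleBump T (fun t => ∑ i ∈ s, f i t) :=
  ⟨ContDiff.sum fun i hi => (hf i hi).contDiff, fun t ht =>
    Finset.sum_eq_zero fun i hi => (hf i hi).eq_zero t ht⟩

theorem deriv (hf : IsMiddleBump T f) : IsMiddleBump T (deriv f) := by
  refine ⟨(contDiff_infty_iff_deriv.1 hf.contDiff).2, fun t ht => ?_⟩
  have : f =ᶠ[nhds t] fun _ => 0 := by
    rcases ht with ht | ht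
    · filter_upwards [Iio_mem_nhds ht] with s hs using hf.eq_zero s (Or.inl hs)
    · filter_upwards [Ioi_mem_nhds ht] with s hs using hf.eq_zero s (Or.inr hs)
  rw [this.deriv_eq, deriv_const]

theorem hasDerivAt (hf : IsMiddleBump T f) (t : ℝ) : HasDerivAt f (_root_.deriv f t) t :=
  ((contDiff_infty_iff_deriv.1 hf.contDiff).1 t).hasDerivAt

end IsMiddleBump

section

variable {ι κ : Type*} [Fintype ι]

/-- Every right-hand side `s(t) e` with `s` supported in the middle third of `(0, T)` can be
compensated by a control `c` and a trajectory `y` supported there. -/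
def Compensable (A : (ι → ℝ) →L[ℝ] (ι → ℝ)) (B : (κ → ℝ) →ₗ[ℝ] (ι → ℝ)) (T : ℝ) (e : ι → ℝ) :
    Prop :=
  ∀ s : ℝ → ℝ, IsMiddleBump T s → ∃ (y : ℝ → ι → ℝ) (c : ℝ → κ → ℝ), IsMiddleBump T y ∧
    (∀ k, IsMiddleBump T fun t => c t k) ∧
    ∀ t, deriv (deriv y) t = A (y t) + s t • e + B (c t)

variable {A : (ι → ℝ) →L[ℝ] (ι → ℝ)} {B : (κ → ℝ) →ₗ[ℝ] (ι → ℝ)} {T : ℝ}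

theorem deriv_deriv_add {y z : ℝ → ι → ℝ} (hy : IsMiddleBump T y) (hz : IsMiddleBump T z) (t : ℝ) :
    deriv (deriv fun t => y t + z t) t = deriv (deriv y) t + deriv (deriv z) t := by
  have h : (deriv fun t => y t + z t) = fun t => deriv y t + deriv z t :=
    funext fun t => ((hy.hasDerivAt t).add (hz.hasDerivAt t)).deriv
  rw [h]
  exact ((hy.deriv.hasDerivAt t).add (hz.deriv.hasDerivAt t)).deriv

theorem deriv_deriv_const_smul {y : ℝ → ι → ℝ} (hy : IsMiddleBump T y) (a t : ℝ) :
    deriv (deriv fun t => a • y t) t = a • deriv (deriv y) t := by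
  have h : (deriv fun t => a • y t) = fun t => a • deriv y t :=
    funext fun t => ((hy.hasDerivAt t).const_smul a).deriv
  rw [h]
  exact ((hy.deriv.hasDerivAt t).const_smul a).deriv

theorem deriv_deriv_smul_const {s : ℝ → ℝ} (hs : IsMiddleBump T s) (e : ι → ℝ) (t : ℝ) :
    deriv (deriv fun t => s t • e) t = deriv (deriv s) t • e := by
  have h : (deriv fun t => s t • e) = fun t => deriv s t • e :=
    funext fun t => ((hs.hasDerivAt t).smul_const e).deriv
  rw [h]
  exact ((hs.deriv.hasDerivAt t).smul_const e).deriv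

theorem Compensable.add {e e' : ι → ℝ} (he : Compensable A B T e) (he' : Compensable A B T e') :
    Compensable A B T (e + e') := by
  intro s hs
  obtain ⟨y, c, hy, hc, h⟩ := he s hs
  obtain ⟨y', c', hy', hc', h'⟩ := he' s hs
  refine ⟨fun t => y t + y' t, fun t => c t + c' t, hy.add hy', fun k => (hc k).add (hc' k),
    fun t => ?_⟩
  rw [deriv_deriv_add hy hy', h, h', map_add, map_add, smul_add]
  abel

theorem Compensable.smul {e : ι → ℝ} (he : Compensable A B T e) (a : ℝ) :
    Compensable A B T (a • e) := by
  intro s hs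
  obtain ⟨y, c, hy, hc, h⟩ := he s hs
  refine ⟨fun t => a • y t, fun t => a • c t, hy.const_smul a, fun k => (hc k).const_smul a,
    fun t => ?_⟩
  rw [deriv_deriv_const_smul hy, h, map_smul, map_smul, smul_add, smul_add, smul_comm a (s t)]

theorem Compensable.zero : Compensable A B T 0 := fun s _ =>
  ⟨fun _ => 0, fun _ => 0, .zero, fun _ => .zero, fun t => by simp⟩

/-- The effect of a control is compensated by the opposite control. -/
theorem Compensable.of_control (b : κ → ℝ) : Compensable A B T (B b) := fun s hs =>
  ⟨fun _ => 0, fun t => (-s t) • b, .zero, fun k => by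
    simpa using (hs.const_smul (-1)).smul_const (b k), fun t => by simp⟩

/-- The trajectory `-s(t) e` trades the right-hand side `s(t) A e` for `s''(t) e`. -/
theorem Compensable.apply {e : ι → ℝ} (he : Compensable A B T e) : Compensable A B T (A e) := by
  intro s hs
  obtain ⟨z, c, hz, hc, h⟩ := he _ hs.deriv.deriv
  refine ⟨fun t => z t + (-1 : ℝ) • s t • e, c, hz.add ((hs.smul_const e).const_smul (-1)), hc,
    fun t => ?_⟩
  rw [deriv_deriv_add hz ((hs.smul_const e).const_smul (-1)),
    deriv_deriv_const_smul (hs.smul_const e), deriv_deriv_smul_const hs, h, map_add, map_smul,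
    map_smul]
  module

/-- The free evolution is smooth. -/
theorem exists_free_solution (A : (ι → ℝ) →L[ℝ] (ι → ℝ)) (U₀ U₁ : ι → ℝ) :
    ∃ U V : ℝ → ι → ℝ, ContDiff ℝ ∞ U ∧ ContDiff ℝ ∞ V ∧ (∀ t, HasDerivAt U (V t) t) ∧
      (∀ t, HasDerivAt V (A (U t)) t) ∧ U 0 = U₀ ∧ V 0 = U₁ := by
  let M : ((ι → ℝ) × (ι → ℝ)) →L[ℝ] ((ι → ℝ) × (ι → ℝ)) :=
    (ContinuousLinearMap.snd ℝ _ _).prod (A ∘L ContinuousLinearMap.fst ℝ _ _)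
  let Z : ℝ → (ι → ℝ) × (ι → ℝ) := fun t => NormedSpace.exp (t • M) (U₀, U₁)
  have hZ : ∀ t, HasDerivAt Z (M (Z t)) t := fun t =>
    (hasDerivAt_exp_smul_const' (𝕂 := ℝ) M t).clm_apply (hasDerivAt_const t (U₀, U₁)) |>.congr_deriv
      (by simp [Z])
  have hexp : ContDiff ℝ ∞ (NormedSpace.exp :
      (((ι → ℝ) × (ι → ℝ)) →L[ℝ] ((ι → ℝ) × (ι → ℝ))) → _) :=
    contDiff_iff_contDiffAt.2 fun x => (NormedSpace.exp_analytic (𝕂 := ℝ) x).contDiffAt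
  have hsm : ContDiff ℝ ∞ Z :=
    (hexp.comp (contDiff_id.smul contDiff_const)).clm_apply contDiff_const
  refine ⟨fun t => (Z t).1, fun t => (Z t).2, contDiff_fst.comp hsm, contDiff_snd.comp hsm,
    fun t => (hZ t).fst, fun t => (hZ t).snd, ?_, ?_⟩ <;> simp [Z]

/-- Null controllability of `U'' = A U + B c` by smooth controls in any positive time, under the
Kalman condition: cut off the free evolution and compensate the resulting right-hand side. -/
theorem exists_null_control (A : (ι → ℝ) →L[ℝ] (ι → ℝ)) (B : (κ → ℝ) →ₗ[ℝ] (ι → ℝ))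
    (hAB : ∀ R : Submodule ℝ (ι → ℝ), (∀ U ∈ R, A U ∈ R) → (∀ b, B b ∈ R) → R = ⊤)
    {T : ℝ} (hT : 0 < T) (U₀ U₁ : ι → ℝ) :
    ∃ (c : ℝ → κ → ℝ) (U V : ℝ → ι → ℝ), (∀ k, ContDiff ℝ ∞ fun t => c t k) ∧
      ContDiff ℝ ∞ U ∧ ContDiff ℝ ∞ V ∧ (∀ t, HasDerivAt U (V t) t) ∧
      (∀ t, HasDerivAt V (A (U t) + B (c t)) t) ∧
      U 0 = U₀ ∧ V 0 = U₁ ∧ U T = 0 ∧ V T = 0 := by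
  classical
  have hall : ∀ e, Compensable A B T e := by
    let R : Submodule ℝ (ι → ℝ) :=
      { carrier := {e | Compensable A B T e}
        add_mem' := fun he he' => he.add he'
        zero_mem' := .zero
        smul_mem' := fun a _ he => he.smul a }
    have hR : R = ⊤ := hAB R (fun U hU => Compensable.apply hU) fun b => .of_control b
    intro e
    have : e ∈ R := hR ▸ Submodule.mem_top
    exact this
  obtain ⟨F, G, hF, hG, hFd, hGd, hF0, hG0⟩ := exists_free_solution A U₀ U₁
  obtain ⟨θ, hθ, hθ1, hθ0⟩ : ∃ θ : ℝ → ℝ, ContDiff ℝ ∞ θ ∧ (∀ t < T / 3, θ t = 1) ∧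
      ∀ t, 2 * T / 3 < t → θ t = 0 := by
    refine ⟨fun t => Real.smoothTransition (2 - 3 / T * t), Real.smoothTransition.contDiff.comp
      (contDiff_const.sub (contDiff_const.mul contDiff_id)), fun t ht => ?_, fun t ht => ?_⟩
    · refine Real.smoothTransition.one_of_one_le ?_
      have : 3 / T * t ≤ 3 / T * (T / 3) := by gcongr
      have h2 : 3 / T * (T / 3) = 1 := by field_simp
      linarith
    · refine Real.smoothTransition.zero_of_nonpos ?_
      have : 3 / T * (2 * T / 3) ≤ 3 / T * t := by gcongr
      have h2 : 3 / T * (2 * T / 3) = 2 := by field_simp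
      linarith
  have hθd : ∀ t, HasDerivAt θ (deriv θ t) t := fun t =>
    ((contDiff_infty_iff_deriv.1 hθ).1 t).hasDerivAt
  have hθ' : IsMiddleBump T (deriv θ) := by
    refine ⟨(contDiff_infty_iff_deriv.1 hθ).2, fun t ht => ?_⟩
    rcases ht with ht | ht
    · have : θ =ᶠ[nhds t] fun _ => 1 := by
        filter_upwards [Iio_mem_nhds ht] with s hs using hθ1 s hs
      rw [this.deriv_eq, deriv_const]
    · have : θ =ᶠ[nhds t] fun _ => 0 := by
        filter_upwards [Ioi_mem_nhds ht] with s hs using hθ0 s hs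
      rw [this.deriv_eq, deriv_const]
  -- the right-hand side `θ'' F + 2 θ' F'` left by the cut-off
  set r : ℝ → ι → ℝ := fun t => deriv (deriv θ) t • F t + (2 * deriv θ t) • G t with hr
  have hrb : IsMiddleBump T r := by
    refine ⟨(hθ'.deriv.contDiff.smul hF).add ((contDiff_const.mul hθ'.contDiff).smul hG),
      fun t ht => ?_⟩
    simp only [hr, hθ'.eq_zero t ht, hθ'.deriv.eq_zero t ht, mul_zero, zero_smul, add_zero]
  have hcomp : ∀ i : ι, IsMiddleBump T fun t => -(r t i) := fun i =>
    ⟨(contDiff_pi.1 hrb.contDiff i).neg, fun t ht => by simp [hrb.eq_zero t ht]⟩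
  choose y c hy hc hyc using fun i : ι => hall (Pi.single i 1) _ (hcomp i)
  have hysum := IsMiddleBump.sum Finset.univ fun i _ => hy i
  set Y : ℝ → ι → ℝ := fun t => ∑ i, y i t with hY
  have hYdd : ∀ t, deriv (deriv Y) t = A (Y t) - r t + B (∑ i, c i t) := by
    intro t
    have h1 : deriv Y = fun t => ∑ i, deriv (y i) t := funext fun t =>
      (HasDerivAt.fun_sum fun i _ => (hy i).hasDerivAt t).deriv
    rw [h1, (HasDerivAt.fun_sum fun i _ => (hy i).deriv.hasDerivAt t).deriv]
    have h2 : r t = ∑ i, r t i • Pi.single i (1 : ℝ) := pi_eq_sum_univ' (r t)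
    simp only [hyc, Finset.sum_add_distrib, neg_smul, Finset.sum_neg_distrib, ← h2, hY, map_sum]
    abel
  refine ⟨fun t => ∑ i, c i t, fun t => θ t • F t + Y t,
    fun t => θ t • G t + deriv θ t • F t + deriv Y t, fun k => ?_, (hθ.smul hF).add hysum.contDiff,
    ((hθ.smul hG).add (hθ'.contDiff.smul hF)).add hysum.deriv.contDiff,
    fun t => ((hθd t).smul (hFd t)).add (hysum.hasDerivAt t), fun t => ?_, ?_, ?_, ?_, ?_⟩
  · simp only [Finset.sum_apply]
    exact ContDiff.sum fun i _ => (hc i k).contDiff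
  · refine ((((hθd t).smul (hGd t)).add ((hθ'.hasDerivAt t).smul (hFd t))).add
      (hysum.deriv.hasDerivAt t)).congr_deriv ?_
    rw [hYdd, hr, map_add, map_smul]
    module
  · have h0 : (0 : ℝ) < T / 3 := by positivity
    simp [hθ1 0 h0, hysum.eq_zero 0 (Or.inl h0), hF0]
  · have h0 : (0 : ℝ) < T / 3 := by positivity
    simp [hθ1 0 h0, hysum.deriv.eq_zero 0 (Or.inl h0), hG0, hθ'.eq_zero 0 (Or.inl h0)]
  · have h0 : 2 * T / 3 < T := by linarith
    simp [hθ0 T h0, hysum.eq_zero T (Or.inr h0)]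
  · have h0 : 2 * T / 3 < T := by linarith
    simp [hθ0 T h0, hysum.deriv.eq_zero T (Or.inr h0), hθ'.eq_zero T (Or.inr h0)]

end

/-! ### Uniqueness of Carathéodory solutions -/

/-- A Carathéodory solution of `w'' = A w` with zero initial data vanishes: `w'` is a primitive of the
continuous function `A w`, so that `w` is a classical solution. -/
theorem eq_zero_of_caratheodory {ι : Type*} [Fintype ι] (A : (ι → ℝ) →L[ℝ] (ι → ℝ)) {T : ℝ}
    (hT : 0 < T) {w η : ℝ → ι → ℝ}
    (hη : ∀ x, AbsolutelyContinuousOnInterval (fun t => η t x) 0 T)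
    (hw : ∀ x, ∀ t ∈ Set.Icc 0 T,
      HasDerivWithinAt (fun t => w t x) (η t x) (Set.Icc 0 T) t)
    (hη' : ∀ x, ∀ᵐ t ∂(MeasureTheory.volume.restrict (Set.Ioo 0 T)),
      HasDerivAt (fun t => η t x) (A (w t) x) t)
    (hw0 : w 0 = 0) (hη0 : η 0 = 0) : ∀ t ∈ Set.Icc 0 T, w t = 0 ∧ η t = 0 := by
  have hwd : ∀ t ∈ Set.Icc 0 T, HasDerivWithinAt w (η t) (Set.Icc 0 T) t := fun t ht =>
    hasDerivWithinAt_pi.2 fun x => hw x t ht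
  have hwc : ContinuousOn w (Set.Icc 0 T) := fun t ht => (hwd t ht).continuousWithinAt
  -- a continuous extension of `w` to the whole line
  set W : ℝ → ι → ℝ := Set.IccExtend hT.le ((Set.Icc 0 T).domRestrict w) with hW
  have hWc : Continuous W := (continuousOn_iff_continuous_domRestrict.1 hwc).Icc_extend'
  have hWw : ∀ t ∈ Set.Icc 0 T, W t = w t := fun t ht => by
    rw [hW, Set.IccExtend_of_mem hT.le _ ht, Set.domRestrict_apply]
  have hAW : ∀ x, Continuous fun t => A (W t) x := fun x =>
    (continuous_apply x).comp (A.continuous.comp hWc)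
  set P : ℝ → ι → ℝ := fun t x => ∫ s in (0 : ℝ)..t, A (W s) x with hP
  have hPd : ∀ x t, HasDerivAt (fun t => P t x) (A (W t) x) t := fun x t =>
    intervalIntegral.integral_hasDerivAt_right ((hAW x).intervalIntegrable _ _)
      ((hAW x).stronglyMeasurableAtFilter _ _) (hAW x).continuousAt
  have hηP : ∀ t ∈ Set.Icc 0 T, η t = P t := by
    intro t ht
    ext x
    have hac : AbsolutelyContinuousOnInterval (fun t => η t x - P t x) 0 T :=
      (hη x).sub (((hAW x).intervalIntegrable 0 T).absolutelyContinuousOnInterval_intervalIntegral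
        Set.left_mem_uIcc)
    obtain ⟨C, hC⟩ := hac.const_of_ae_hasDerivAt_zero (by
      have h := hη' x
      rw [MeasureTheory.Measure.restrict_congr_set MeasureTheory.Ioo_ae_eq_Icc,
        MeasureTheory.ae_restrict_iff' measurableSet_Icc] at h
      rw [Set.uIcc_of_le hT.le]
      filter_upwards [h] with s hs hsI
      have := (hs hsI).sub (hPd x s)
      rwa [hWw s hsI, sub_self] at this)
    rw [Set.uIcc_of_le hT.le] at hC
    have h0 := hC 0 (Set.left_mem_Icc.2 hT.le)
    have h1 := hC t ht
    simp only [hη0, hP, intervalIntegral.integral_same, Pi.zero_apply, sub_zero] at h0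
    rw [← h0] at h1
    exact sub_eq_zero.1 h1
  let M : ((ι → ℝ) × (ι → ℝ)) →L[ℝ] ((ι → ℝ) × (ι → ℝ)) :=
    (ContinuousLinearMap.snd ℝ _ _).prod (A ∘L ContinuousLinearMap.fst ℝ _ _)
  have hPd' : ∀ t, HasDerivAt P (A (W t)) t := fun t => hasDerivAt_pi.2 fun x => hPd x t
  have huniq : Set.EqOn (fun t => (w t, P t)) (fun _ => 0) (Set.Icc 0 T) := by
    refine ODE_solution_unique (v := fun _ => M) (fun _ => M.lipschitz)
      (hwc.prodMk (continuous_iff_continuousAt.2 fun t => (hPd' t).continuousAt).continuousOn)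
      (fun t ht => ?_) continuousOn_const (fun t _ => ?_) ?_
    · have ht' := Set.Ico_subset_Icc_self ht
      have h1 : HasDerivWithinAt w (P t) (Set.Ici t) t := by
        rw [← hηP t ht']
        exact (hwd t ht').mono_of_mem_nhdsWithin (Icc_mem_nhdsGE_of_mem ht)
      have h2 : HasDerivWithinAt P (A (w t)) (Set.Ici t) t := by
        rw [← hWw t ht']
        exact (hPd' t).hasDerivWithinAt
      exact h1.prodMk h2
    · rw [map_zero]
      exact hasDerivWithinAt_const _ _ _
    · ext x <;> simp [hw0, hP]
  intro t ht
  have h := huniq ht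
  rw [Prod.mk_eq_zero] at h
  exact ⟨h.1, (hηP t ht).trans h.2⟩

/-! ### The control operator -/

/-- The values at the controlled sides, extended by zero to the other nodes.  The nodes of the
uncontrolled sides, among them three corners, are left out. -/
noncomputable def controlledPart (N : Fin 2 → ℕ) :
    ((Fin 2 → ℝ) → ℝ) →ₗ[ℝ] (Fin 2 → ℝ) → ℝ where
  toFun F x := if x ∈ interiorFinset N ∨ x 0 = -1 ∨ x 1 = -1 then 0 else F x
  map_add' F G := by
    ext x
    by_cases h : x ∈ interiorFinset N ∨ x 0 = -1 ∨ x 1 = -1 <;> simp [h]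
  map_smul' c F := by
    ext x
    by_cases h : x ∈ interiorFinset N ∨ x 0 = -1 ∨ x 1 = -1 <;> simp [h]

theorem controlledPart_apply (N : Fin 2 → ℕ) (F : (Fin 2 → ℝ) → ℝ) (x : Fin 2 → ℝ) :
    controlledPart N F x = if x ∈ interiorFinset N ∨ x 0 = -1 ∨ x 1 = -1 then 0 else F x := rfl

/-- Index set of the nodal values of the controls: the boundary control at a point of the plane, and
the artificial control on a side at a tangential coordinate.  Only finitely many of them matter. -/
abbrev ControlIndex : Type := (Fin 2 → ℝ) ⊕ (Fin 4 × ℝ)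

/-- The effect of the artificial controls on the interior nodes. -/
noncomputable def artificialOperator (N : Fin 2 → ℕ) :
    (ControlIndex → ℝ) →ₗ[ℝ] InteriorValues N :=
  LinearMap.pi fun x => ∑ k, (profile (N (axis k)) (endpoint k)).eval (x.1 (axis k)) •
    LinearMap.proj (Sum.inr (k, x.1 (tangent k)))

/-- The effect of all the controls on the interior nodes: the boundary control acts through the
collocated Laplacian, the artificial ones through their profiles. -/
noncomputable def controlOperator (N : Fin 2 → ℕ) : (ControlIndex → ℝ) →ₗ[ℝ] InteriorValues N :=
  interiorLaplacian N ∘ₗ gridInterp N ∘ₗ controlledPart N ∘ₗ LinearMap.funLeft ℝ ℝ Sum.inl +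
    artificialOperator N

theorem artificialOperator_apply (N : Fin 2 → ℕ) (c : ControlIndex → ℝ) (x : interiorFinset N) :
    artificialOperator N c x = ∑ k, c (Sum.inr (k, x.1 (tangent k))) *
      (profile (N (axis k)) (endpoint k)).eval (x.1 (axis k)) := by
  simp [artificialOperator, mul_comm]

theorem axis_ne_tangent (k : Fin 4) : axis k ≠ tangent k := by
  fin_cases k <;> simp [axis, tangent]

theorem exists_side {i j : Fin 2} (hij : i ≠ j) {e : ℝ} (he : e = 1 ∨ e = -1) :
    ∃ k, axis k = i ∧ tangent k = j ∧ endpoint k = e := by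
  rcases he with rfl | rfl
  · fin_cases i <;> fin_cases j <;> simp at hij
    · exact ⟨0, rfl, rfl, rfl⟩
    · exact ⟨1, rfl, rfl, rfl⟩
  · fin_cases i <;> fin_cases j <;> simp at hij
    · exact ⟨2, rfl, rfl, rfl⟩
    · exact ⟨3, rfl, rfl, rfl⟩

/-- Each column of the artificial controls is in the range of the control operator. -/
theorem controlOperator_single (N : Fin 2 → ℕ) (k : Fin 4) (b : ℝ) :
    controlOperator N (Pi.single (Sum.inr (k, b)) 1) =
      artificialColumn N (axis k) (tangent k) (endpoint k) b := by
  have h0 : LinearMap.funLeft ℝ ℝ (Sum.inl : (Fin 2 → ℝ) → ControlIndex)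
      (Pi.single (Sum.inr (k, b)) 1) = 0 := by
    ext z
    simp [LinearMap.funLeft_apply]
  ext x
  rw [controlOperator, LinearMap.add_apply, LinearMap.comp_apply, LinearMap.comp_apply,
    LinearMap.comp_apply, h0, map_zero, map_zero, map_zero, zero_add, artificialOperator_apply,
    Finset.sum_eq_single_of_mem k (Finset.mem_univ k), artificialColumn]
  · by_cases h : x.1 (tangent k) = b
    · rw [h, Pi.single_eq_same, one_mul, if_pos rfl]
    · rw [if_neg h, Pi.single_eq_of_ne (by simpa using h), zero_mul]
  · intro l _ hl
    rw [Pi.single_eq_of_ne (by simp [hl]), zero_mul]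

theorem eq_top_of_controlOperator_mem {N : Fin 2 → ℕ} (hN : ∀ i, 1 ≤ N i)
    (R : Submodule ℝ (InteriorValues N)) (hA : ∀ U ∈ R, dirichletLaplacian N U ∈ R)
    (hB : ∀ c, controlOperator N c ∈ R) : R = ⊤ := by
  refine eq_top_of_artificialColumn_mem hN R hA fun i j hij e he b _ => ?_
  obtain ⟨k, rfl, rfl, rfl⟩ := exists_side hij he
  rw [← controlOperator_single]
  exact hB _

/-! ### Nodal values and polynomial trajectories -/

/-- The values at all the nodes, given those at the interior nodes and the controls. -/
noncomputable def nodalValues (N : Fin 2 → ℕ) (U : InteriorValues N) (c : ControlIndex → ℝ) :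
    (Fin 2 → ℝ) → ℝ :=
  extendByZero N U + controlledPart N (fun x => c (Sum.inl x))

theorem nodalValues_of_mem {N : Fin 2 → ℕ} (U : InteriorValues N) (c : ControlIndex → ℝ)
    {x : Fin 2 → ℝ} (hx : x ∈ interiorFinset N) : nodalValues N U c x = U ⟨x, hx⟩ := by
  rw [nodalValues, Pi.add_apply, extendByZero_of_mem _ hx, controlledPart_apply,
    if_pos (Or.inl hx), add_zero]

theorem nodalValues_of_eq {N : Fin 2 → ℕ} (U : InteriorValues N) (c : ControlIndex → ℝ)
    {x : Fin 2 → ℝ} (hx : x 0 = -1 ∨ x 1 = -1) : nodalValues N U c x = 0 := by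
  have hx' : x ∉ interiorFinset N := by
    rcases hx with h | h
    · exact notMem_interiorFinset 0 (Or.inr h)
    · exact notMem_interiorFinset 1 (Or.inr h)
  rw [nodalValues, Pi.add_apply, extendByZero_of_notMem _ hx', controlledPart_apply,
    if_pos (Or.inr hx), add_zero]

theorem nodalValues_congr_of_notMem {N : Fin 2 → ℕ} (U V : InteriorValues N) (c : ControlIndex → ℝ)
    {x : Fin 2 → ℝ} (hx : x ∉ interiorFinset N) : nodalValues N U c x = nodalValues N V c x := by
  rw [nodalValues, nodalValues, Pi.add_apply, Pi.add_apply, extendByZero_of_notMem _ hx,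
    extendByZero_of_notMem _ hx]

/-- The right-hand side of the collocation system in terms of the two operators. -/
theorem eval_laplacian_gridInterp_nodalValues {N : Fin 2 → ℕ} (U : InteriorValues N)
    (c : ControlIndex → ℝ) (x : interiorFinset N) :
    eval x.1 (laplacian (gridInterp N (nodalValues N U c))) + artificialOperator N c x =
      (dirichletLaplacian N U + controlOperator N c) x := by
  rw [← interiorLaplacian_apply, nodalValues, map_add, map_add, controlOperator]
  simp only [Pi.add_apply, LinearMap.add_apply, dirichletLaplacian, LinearMap.comp_apply]
  rw [show LinearMap.funLeft ℝ ℝ (Sum.inl : (Fin 2 → ℝ) → ControlIndex) c =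
    fun x => c (Sum.inl x) from rfl]
  ring

theorem contDiff_nodalValues {N : Fin 2 → ℕ} {U : ℝ → InteriorValues N} {c : ℝ → ControlIndex → ℝ}
    (hU : ContDiff ℝ ∞ U) (hc : ∀ k, ContDiff ℝ ∞ fun t => c t k) (x : Fin 2 → ℝ) :
    ContDiff ℝ ∞ fun t => nodalValues N (U t) (c t) x := by
  refine ContDiff.add ?_ ?_
  · by_cases h : x ∈ interiorFinset N
    · simp only [extendByZero_of_mem _ h]
      exact contDiff_pi.1 hU _
    · simp only [extendByZero_of_notMem _ h]
      exact contDiff_const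
  · simp only [controlledPart_apply]
    split_ifs
    · exact contDiff_const
    · exact hc _

theorem eval_gridInterp_eq_sum (N : Fin 2 → ℕ) (F : (Fin 2 → ℝ) → ℝ) (x : Fin 2 → ℝ) :
    eval x (gridInterp N F) = ∑ z ∈ gridFinset N, F z * eval x (gridCardinal N z) := by
  simp only [gridInterp_apply, map_sum, smul_eval]

theorem mem_gridFinset_iff {N : Fin 2 → ℕ} {x : Fin 2 → ℝ} : x ∈ gridFinset N ↔ x ∈ grid N :=
  mem_gridFinset

/-! ### Discrete controls -/

theorem memLp_two_of_continuous {h : ℝ × ℝ → ℝ} (hh : Continuous h) (T : ℝ) :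
    MeasureTheory.MemLp h 2 ((MeasureTheory.volume.restrict (Set.Ioo 0 T)).prod
      (MeasureTheory.volume.restrict (Set.Icc (-1 : ℝ) 1))) := by
  obtain ⟨C, hC⟩ := (isCompact_Icc.prod isCompact_Icc :
    IsCompact (Set.Icc (0 : ℝ) T ×ˢ Set.Icc (-1 : ℝ) 1)).exists_bound_of_continuousOn
      hh.continuousOn
  refine MeasureTheory.MemLp.of_bound hh.aestronglyMeasurable C ?_
  rw [MeasureTheory.Measure.prod_restrict]
  refine (MeasureTheory.ae_restrict_iff' (measurableSet_Ioo.prod measurableSet_Icc)).2 ?_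
  exact Filter.Eventually.of_forall fun q hq => hC q ⟨Set.Ioo_subset_Icc_self hq.1, hq.2⟩

theorem sidePoint_tangent (k : Fin 4) (s : ℝ) : sidePoint k s (tangent k) = s :=
  Function.update_of_ne (axis_ne_tangent k).symm _ (fun _ : Fin 2 => s)

theorem continuous_sidePoint (k : Fin 4) : Continuous (sidePoint k) :=
  (continuous_pi fun _ => continuous_id).update (axis k) continuous_const

/-- The trace on a side of a polynomial whose nodal values depend continuously on time is a discrete
control. -/
theorem isDiscreteControl_gridInterp {N : Fin 2 → ℕ} (hN : ∀ i, 1 ≤ N i) (T : ℝ) (k : Fin 4)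
    {F : ℝ → (Fin 2 → ℝ) → ℝ} (hF : ∀ z, Continuous fun t => F t z) :
    IsDiscreteControl N T k fun t x => eval x (gridInterp N (F t)) := by
  refine ⟨fun t _ => ⟨slice (tangent k) (fun _ => endpoint k) (gridInterp N (F t)),
    (natDegree_slice_le _ _ _).trans (gridInterp_mem_polySpace hN _ _), fun x hx => ?_⟩, ?_⟩
  · have hx' : x (axis k) = endpoint k := hx.1
    rw [eval_slice, ← hx', update_const_eq (axis_ne_tangent k).symm]
  · refine memLp_two_of_continuous ?_ T
    simp only [eval_gridInterp_eq_sum]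
    refine continuous_finsetSum _ fun z _ => ((hF z).comp continuous_fst).mul ?_
    exact (gridCardinal N z).continuous_eval.comp ((continuous_sidePoint k).comp continuous_snd)

/-- The control on the side `k` with given values at the nodes of the side. -/
noncomputable def sideInterp (N : Fin 2 → ℕ) (k : Fin 4) (γ : ℝ → ℝ) (x : Fin 2 → ℝ) : ℝ :=
  ∑ b ∈ lglNodes (N (tangent k)), γ b * (cardinal (N (tangent k)) b).eval (x (tangent k))

theorem sideInterp_of_mem {N : Fin 2 → ℕ} {k : Fin 4} {γ : ℝ → ℝ} {x : Fin 2 → ℝ}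
    (hx : x (tangent k) ∈ lglNodes (N (tangent k))) : sideInterp N k γ x = γ (x (tangent k)) := by
  rw [sideInterp, Finset.sum_eq_single_of_mem _ hx, eval_cardinal_self hx, mul_one]
  intro b _ hb
  rw [eval_cardinal_of_ne hb hx, mul_zero]

theorem isDiscreteControl_sideInterp {N : Fin 2 → ℕ} (hN : ∀ i, 1 ≤ N i) (T : ℝ) (k : Fin 4)
    {γ : ℝ → ℝ → ℝ} (hγ : ∀ b, Continuous fun t => γ t b) :
    IsDiscreteControl N T k fun t => sideInterp N k (γ t) := by
  refine ⟨fun t _ => ⟨∑ b ∈ lglNodes (N (tangent k)),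
    Polynomial.C (γ t b) * cardinal (N (tangent k)) b, ?_, fun x _ => ?_⟩, ?_⟩
  · refine Polynomial.natDegree_sum_le_of_forall_le _ _ fun b hb => ?_
    exact (Polynomial.natDegree_C_mul_le _ _).trans (natDegree_cardinal (hN _) hb).le
  · simp [sideInterp, Polynomial.eval_finsetSum]
  · refine memLp_two_of_continuous ?_ T
    simp only [sideInterp, sidePoint_tangent]
    refine continuous_finsetSum _ fun b _ => ((hγ b).comp continuous_fst).mul ?_
    exact (cardinal (N (tangent k)) b).continuous.comp continuous_snd

theorem source_sideInterp {N : Fin 2 → ℕ} (c : ℝ → ControlIndex → ℝ) (t : ℝ)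
    (x : interiorFinset N) :
    source N (fun k t => sideInterp N k fun b => c t (Sum.inr (k, b))) t x.1 =
      artificialOperator N (c t) x := by
  rw [source, artificialOperator_apply]
  refine Finset.sum_congr rfl fun k _ => ?_
  have h : sideProj k x.1 (tangent k) = x.1 (tangent k) :=
    Function.update_of_ne (axis_ne_tangent k).symm _ _
  rw [sideInterp_of_mem, h]
  rw [h]
  exact mem_gridFinset.1 (Finset.mem_filter.1 x.2).1 _

theorem coord_eq_neg_one_of_mem_side {x : Fin 2 → ℝ} (hx : x ∈ side 2 ∪ side 3) :
    x 0 = -1 ∨ x 1 = -1 := hx.imp (fun h => h.1) fun h => h.1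

theorem mem_side_or_mem_side {N : Fin 2 → ℕ} (hN : ∀ i, 1 ≤ N i) {x : Fin 2 → ℝ}
    (hx : x ∈ gridFinset N) (hx' : x ∉ interiorFinset N) :
    x ∈ side 2 ∪ side 3 ∨ x ∈ side 0 ∪ side 1 := by
  have hI := fun i => mem_Icc_of_mem_lglNodes (hN i) (mem_gridFinset.1 hx i)
  obtain ⟨i, hi⟩ := exists_endpoint_of_notMem_interiorFinset hN hx hx'
  obtain ⟨j, hij⟩ : ∃ j, i ≠ j := ⟨1 - i, by omega⟩
  fin_cases i
  · rcases hi with h | h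
    · exact Or.inr (Or.inl ⟨h, hI 1⟩)
    · exact Or.inl (Or.inl ⟨h, hI 1⟩)
  · rcases hi with h | h
    · exact Or.inr (Or.inr ⟨h, hI 0⟩)
    · exact Or.inl (Or.inr ⟨h, hI 0⟩)

/-! ### Null controllability of the collocation system -/

/-- At almost every time, a solution is the interpolant of its interior values and the controls. -/
theorem IsSolution.ae_eq_gridInterp {N : Fin 2 → ℕ} (hN : ∀ i, 1 ≤ N i) {T : ℝ}
    {c : ℝ → ControlIndex → ℝ} {U : ℝ → InteriorValues N}
    {g : Fin 4 → ℝ → (Fin 2 → ℝ) → ℝ} {u0 u1 : MvPolynomial (Fin 2) ℝ}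
    {u : ℝ → MvPolynomial (Fin 2) ℝ}
    (hu : IsSolution N T (fun t x => eval x (gridInterp N (nodalValues N (U t) (c t)))) g u0 u1 u) :
    ∀ᵐ t ∂(MeasureTheory.volume.restrict (Set.Ioo 0 T)),
      u t = gridInterp N (nodalValues N (fun x => eval x.1 (u t)) (c t)) := by
  have hbdry : ∀ x ∈ gridFinset N, x ∉ interiorFinset N →
      ∀ᵐ t ∂(MeasureTheory.volume.restrict (Set.Ioo 0 T)),
        eval x (u t) = nodalValues N (fun x => eval x.1 (u t)) (c t) x := by
    intro x hx hx'
    rcases mem_side_or_mem_side hN hx hx' with h | h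
    · filter_upwards [hu.uncontrolled x (mem_gridFinset_iff.1 hx) h] with t ht
      rw [ht, nodalValues_of_eq _ _ (coord_eq_neg_one_of_mem_side h)]
    · filter_upwards [hu.controlled x (mem_gridFinset_iff.1 hx) h] with t ht
      rw [ht, eval_gridInterp hx]
      exact nodalValues_congr_of_notMem _ _ _ hx'
  have hall : ∀ᵐ t ∂(MeasureTheory.volume.restrict (Set.Ioo 0 T)), ∀ x ∈ gridFinset N,
      x ∉ interiorFinset N →
        eval x (u t) = nodalValues N (fun x => eval x.1 (u t)) (c t) x := by
    refine (MeasureTheory.ae_ball_iff (gridFinset N).countable_toSet).2 fun x hx => ?_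
    by_cases hx' : x ∈ interiorFinset N
    · exact Filter.Eventually.of_forall fun t h => absurd hx' h
    · filter_upwards [hbdry x hx hx'] with t ht _ using ht
  filter_upwards [hall, MeasureTheory.ae_restrict_mem measurableSet_Ioo] with t ht htI
  refine gridInterp_eval hN (hu.mem_polySpace t (Set.Ioo_subset_Icc_self htI)) fun x hx => ?_
  by_cases hx' : x ∈ interiorFinset N
  · rw [nodalValues_of_mem _ _ hx']
  · exact ht x hx hx'

/-- The interior values of a solution are determined by the controls and the initial data. -/
theorem IsSolution.eq_classical {N : Fin 2 → ℕ} (hN : ∀ i, 1 ≤ N i) {T : ℝ} (hT : 0 < T)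
    {c : ℝ → ControlIndex → ℝ} {U V : ℝ → InteriorValues N} {u0 u1 : MvPolynomial (Fin 2) ℝ}
    (hV : ContDiff ℝ ∞ V) (hUV : ∀ t, HasDerivAt U (V t) t)
    (hVU : ∀ t, HasDerivAt V (dirichletLaplacian N (U t) + controlOperator N (c t)) t)
    (hU0 : U 0 = fun x => eval x.1 u0) (hV0 : V 0 = fun x => eval x.1 u1)
    {u : ℝ → MvPolynomial (Fin 2) ℝ}
    (hu : IsSolution N T (fun t x => eval x (gridInterp N (nodalValues N (U t) (c t))))
      (fun k t => sideInterp N k fun b => c t (Sum.inr (k, b))) u0 u1 u) :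
    ∀ x : interiorFinset N, ∀ t ∈ Set.Icc 0 T, eval x.1 (u t) = U t x ∧
      HasDerivWithinAt (fun s => eval x.1 (u s)) (V t x) (Set.Icc 0 T) t := by
  choose v hvac hvd hve hv0 hv1 using fun x : interiorFinset N =>
    hu.equation x.1 (mem_interiorFinset.1 x.2)
  have hUx : ∀ x t, HasDerivAt (fun t => U t x) (V t x) t := fun x t => hasDerivAt_pi.1 (hUV t) x
  have hVx : ∀ x t, HasDerivAt (fun t => V t x)
      ((dirichletLaplacian N (U t) + controlOperator N (c t)) x) t :=
    fun x t => hasDerivAt_pi.1 (hVU t) x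
  have key := eq_zero_of_caratheodory (LinearMap.toContinuousLinearMap (dirichletLaplacian N)) hT
    (w := fun t x => eval x.1 (u t) - U t x) (η := fun t x => v x t - V t x)
    (fun x => (hvac x).sub
      ((contDiff_pi.1 hV x).of_le
        (by exact_mod_cast le_top)).contDiffOn.absolutelyContinuousOnInterval)
    (fun x t ht => (hvd x t ht).sub (hUx x t).hasDerivWithinAt)
    (fun x => by
      filter_upwards [hve x, hu.ae_eq_gridInterp hN] with t ht hut
      refine (ht.sub (hVx x t)).congr_deriv ?_
      conv_lhs => rw [hut]
      rw [source_sideInterp, eval_laplacian_gridInterp_nodalValues,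
        LinearMap.coe_toContinuousLinearMap',
        show (fun x : interiorFinset N => eval x.1 (u t) - U t x) =
          (fun x : interiorFinset N => eval x.1 (u t)) - U t from rfl, map_sub]
      simp only [Pi.add_apply, Pi.sub_apply]
      ring)
    (by
      ext x
      simp [hU0, hv0])
    (by
      ext x
      simp [hV0, hv1])
  intro x t ht
  obtain ⟨h1, h2⟩ := key t ht
  have h2' : v x t = V t x := sub_eq_zero.1 (congrFun h2 x)
  exact ⟨sub_eq_zero.1 (congrFun h1 x), h2' ▸ hvd x t ht⟩

end Collocation

theorem theorem4 (N : Fin 2 → ℕ) (hN : ∀ i, 1 ≤ N i) (T : ℝ)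
    (hT : 4 * √2 * (2 + (N 0 : ℝ)⁻¹) * (2 + (N 1 : ℝ)⁻¹) < T)
    (u0 u1 : MvPolynomial (Fin 2) ℝ)
    (hu0 : u0 ∈ Collocation.polySpaceDi N) (hu1 : u1 ∈ Collocation.polySpaceDi N) :
    ∃ (f : ℝ → (Fin 2 → ℝ) → ℝ) (g : Fin 4 → ℝ → (Fin 2 → ℝ) → ℝ),
      (Collocation.IsDiscreteControl N T 0 f ∧ Collocation.IsDiscreteControl N T 1 f) ∧
      (∀ k, Collocation.IsDiscreteControl N T k (g k)) ∧
      (∃ u, Collocation.IsSolution N T f g u0 u1 u ∧ Collocation.IsSmoothInTime T u) ∧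
      (∀ u, Collocation.IsSolution N T f g u0 u1 u → Collocation.IsAtRest N T u) := by
  open Collocation in
  have hT0 : 0 < T := lt_of_le_of_lt (by positivity) hT
  obtain ⟨c, U, V, hc, hU, hV, hUV, hVU, hU0, hV0, hUT, hVT⟩ := exists_null_control
    (LinearMap.toContinuousLinearMap (dirichletLaplacian N)) (controlOperator N)
    (eq_top_of_controlOperator_mem hN) hT0
    (fun x => MvPolynomial.eval x.1 u0) (fun x => MvPolynomial.eval x.1 u1)
  have hF := contDiff_nodalValues hU hc
  refine ⟨fun t x => MvPolynomial.eval x (gridInterp N (nodalValues N (U t) (c t))),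
    fun k t => sideInterp N k fun b => c t (Sum.inr (k, b)),
    ⟨isDiscreteControl_gridInterp hN T 0 fun z => (hF z).continuous,
      isDiscreteControl_gridInterp hN T 1 fun z => (hF z).continuous⟩,
    fun k => isDiscreteControl_sideInterp hN T k fun b => (hc _).continuous,
    ⟨fun t => gridInterp N (nodalValues N (U t) (c t)),
      ⟨fun t _ => gridInterp_mem_polySpace hN _, fun x hx => ?_, fun x _ _ => by simp,
        fun x hx hs => Filter.Eventually.of_forall fun t => ?_⟩, fun x => ?_⟩, fun u hu x hx => ?_⟩
  · have hxI := mem_interiorFinset.2 hx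
    have hev : ∀ t, MvPolynomial.eval x (gridInterp N (nodalValues N (U t) (c t))) =
        U t ⟨x, hxI⟩ := fun t => by
      rw [eval_gridInterp (Finset.mem_filter.1 hxI).1, nodalValues_of_mem _ _ hxI]
    refine ⟨fun t => V t ⟨x, hxI⟩,
      ((contDiff_pi.1 hV _).of_le
        (by exact_mod_cast le_top)).contDiffOn.absolutelyContinuousOnInterval,
      fun t _ => ?_, Filter.Eventually.of_forall fun t => ?_, ?_, ?_⟩
    · simp only [hev]
      exact (hasDerivAt_pi.1 (hUV t) _).hasDerivWithinAt
    · rw [source_sideInterp c t ⟨x, hxI⟩, eval_laplacian_gridInterp_nodalValues _ _ ⟨x, hxI⟩]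
      exact hasDerivAt_pi.1 (hVU t) ⟨x, hxI⟩
    · rw [hev, hU0]
    · exact congrFun hV0 _
  · rw [eval_gridInterp (mem_gridFinset_iff.2 hx),
      nodalValues_of_eq _ _ (coord_eq_neg_one_of_mem_side hs)]
  · simp only [eval_gridInterp_eq_sum]
    exact (ContDiff.sum fun z _ => (hF z).mul contDiff_const).contDiffOn
  · obtain ⟨h1, h2⟩ := hu.eq_classical hN hT0 hV hUV hVU hU0 hV0 ⟨x, mem_interiorFinset.2 hx⟩ T
      (Set.right_mem_Icc.2 hT0.le)
    rw [hUT] at h1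
    rw [hVT] at h2
    exact ⟨h1, h2⟩
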